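/- **Setting.** Let $\lambda,k,K>0$ and let $\mu,\sigma:[0,\infty)\to\mathbb R$ satisfy: $|\mu(x)|+|\sigma(x)|\le C(1+x)$ for some $C>0$; $\mu,\sigma$ are continuously differentiable and Lipschitz with Lipschitz derivatives; $\sigma^2>0$ on $[0,\infty)$; and there is $x_\lambda\in[0,\infty)$ with $\mu'(x)>\lambda$ for $0\le x<x_\lambda$ and $\mu'(x)\le\lambda$ for $x\ge x_\lambda$. Put $Lf=\tfrac12\sigma^2f''+\mu f'-\lambda f$ and $m(x)=\mu(x)k-\lambda(kx-K)$. Let $g_1,g_2\in C^2[0,\infty)$ solve $Lg_i=0$, with $g_1(0)=1$, $g_1'(x_\lambda)=0$, and $g_2$ strictly increasing with $g_2(0)=1$, $g_2'(0)>0$. Write $g(x;\beta)=g_2(x)-\beta g_1(x)$, $g(x)=g(x;1)$, with $'$ denoting $d/dx$. For $a_1<a_2$ let $I(a_1,a_2,c)=k(a_2-a_1)-c\,(g(a_2)-g(a_1))$. Let $C=C_1\cup C_2$, where $C_1$ is the set of $c>0$ for which there are $0<\underline u<\bar u$ with $cg'(\underline u)=cg'(\bar u)=k$ and $I(\underline u,\bar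 u,c)=K$, and $C_2$ is the set of $c>0$ for which there is $\bar u>0$ with $cg'(\bar u)=k$, $cg'(0)<k$ and $I(0,\bar u,c)=K$. Let $c^*=\max C$, $U=\{u\ge0:c^*g'(u)=k\}$, $\bar u^*=\max\{u\in U: I(\underline u,u,c^*)=K\text{ for some }\underline u\in\{0\}\cup U,\ \underline u<u\}$ and $\underline u^*=\max\{u\in\{0\}\cup U: u<\bar u^*,\ I(u,\bar u^*,c^*)=K\}$. **Problem 1 (assumptions).** There are $0<x_1^*\le x_\lambda\le x_2^*<\infty$ such that $g$ is convex on $[0,x_1^*)$, concave on $[x_1^*,x_2^*)$ and convex on $[x_2^*,\infty)$; the maxima above exist and $0=\underline u^*<\bar u^*<x_1^*$, with either $c^*g'(x_2^*)\ge k$ (case R5) or $c^*g'(x_2^*)<k$ (case R6); and $m(x_\lambda)>0$. **Notation.** Let $\underline z$ be the unique zero of $m$ in $(x_1^*,x_\lambda)$; $\gamma(\beta,x)=k\left(\frac{g(x;\beta)}{g'(x;\beta)}-x\right)+K$; $h=g_2''/g_1''$ and $h_\infty=\lim_{x\to\infty}h(x)\in(-\infty,\infty]$. Let $h_-^{-1}$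 be the inverse of $h$ on $[x_1^*,x_\lambda]$, and $h_+^{-1}$ a right inverse of $h$ on $[x_\lambda,\infty)$, i.e. $h_+^{-1}(\beta)\ge x_\lambda$ and $h(h_+^{-1}(\beta))=\beta$ for $\beta\in[h(x_\lambda),h_\infty)$. For $\beta\in[h(\underline z),1]$ let $u_1(\beta)$ be the unique zero of $\gamma(\beta,\cdot)$ in $[\bar u^*,\underline z]$. Let $$v(\beta)=\frac{g'(h_+^{-1}(\beta);\beta)}{g'(u_1(\beta);\beta)}\ \text{ if }\beta\in[h(\underline z),1],\ \beta<h_\infty,\qquad v(\beta)=\infty\ \text{ otherwise},$$ $$\beta_0=\sup\{\beta_1\in(h(\underline z),1]: v(\beta)\le1\text{ for all }\beta\in(h(\underline z),\beta_1]\},\qquad G(\beta)=\frac{\lim_{x\to\infty}g'(x;\beta)}{g'(u_1(\beta);\beta)}\in(-\infty,\infty].$$ Let $\alpha_0=h(\underline z)$ if $G(h(\underline z))\ge1$; otherwise let $\alpha_0$ be the number in $(h(\underline z),\beta_0)$ with $G(\alpha_0)=1$, if it exists. For $\beta\in(\alpha_0,\beta_0)$ let $u_2(\beta)\in(h_-^{-1}(\beta),h_+^{-1}(\beta))$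 and $u_3(\beta)>h_+^{-1}(\beta)$ be the points with $g'(u_2(\beta);\beta)=g'(u_3(\beta);\beta)=g'(u_1(\beta);\beta)$. Let $J(\beta,a,b)=k\left(b-a-\frac{g(b;\beta)-g(a;\beta)}{g'(b;\beta)}\right)$, and let $J_2(\alpha_0)$ and $J_{13}(\alpha_0)$ be the (possibly infinite) limits of $J(\beta,u_2(\beta),u_3(\beta))$ and $J(\beta,u_1(\beta),u_3(\beta))$ as $\beta\downarrow\alpha_0$. Consider the cases - G1: $G(h(\underline z))\ge1$; - G2: $G(h(\underline z))<1$, $\alpha_0$ exists and $J_{13}(\alpha_0)\ge0$; - G3: $G(h(\underline z))<1$, $\alpha_0$ exists, $J_{13}(\alpha_0)<0$ and $J_2(\alpha_0)>K$. **Proposition 2.1.** Assume Problem 1 and one of G1, G2, G3; if G2 holds with $J_{13}(\alpha_0)=0$, assume also $J_2(\alpha_0)>K$. Then there is $\tilde\beta\in(\alpha_0,\beta_0)$ such that the numbers $\tilde u_i=u_i(\tilde\beta)$, $i=1,2,3$, satisfy $$\bar u^*<\tilde u_1<h_-^{-1}(\tilde\beta)<\underline z<\tilde u_2<h_+^{-1}(\tilde\beta)<\tilde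 u_3$$ and 1. (i) $\gamma(\tilde\beta,\tilde u_1)=0$; 2. (ii) $g'(\tilde u_1;\tilde\beta)=g'(\tilde u_2;\tilde\beta)=g'(\tilde u_3;\tilde\beta)$; 3. (iii) exactly one of the following holds: (iii-a) $-J(\tilde\beta,\tilde u_1,\tilde u_2)=J(\tilde\beta,\tilde u_2,\tilde u_3)\le K$; (iii-b) $-J(\tilde\beta,\tilde u_1,\tilde u_2)>J(\tilde\beta,\tilde u_2,\tilde u_3)=K$. In case G3, (iii-b) holds. -/

import Mathlib

open Set Filter Topology

noncomputable section

/-- Derivative of a function on the half line `[0, ∞)`, one-sided at `0`. -/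
def halfLineDeriv (f : ℝ → ℝ) : ℝ → ℝ := derivWithin f (Ici 0)

/-- The data of the dividend problem on the half line. It carries no laws: these are the
predicates below.

`mu`, `sigma` are the drift and the diffusion coefficient, `lam` the discounting rate, `k` the
proportion kept after proportional costs, `K` the fixed cost; `xlam` is the point where the
derivative of `mu` crosses `lam`; `g1`, `g2` are two solutions of `L g = 0`; `x1`, `x2` are the
points where the canonical solution `g2 - g1` changes from convex to concave and back; `cstar`,
`ubar`, `ulow` are the optimal coefficient and the upper and lower barrier of the simple barrier
problem. -/
structure DividendModel where
  mu : ℝ → ℝ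
  sigma : ℝ → ℝ
  lam : ℝ
  k : ℝ
  K : ℝ
  xlam : ℝ
  g1 : ℝ → ℝ
  g2 : ℝ → ℝ
  x1 : ℝ
  x2 : ℝ
  cstar : ℝ
  ubar : ℝ
  ulow : ℝ

namespace DividendModel

/-- Standing assumptions on the coefficients and on the point `xlam`. -/
structure CoefficientAssumptions (d : DividendModel) : Prop where
  lam_pos : 0 < d.lam
  k_pos : 0 < d.k
  K_pos : 0 < d.K
  linear_growth : ∃ C : ℝ, 0 < C ∧ ∀ x, 0 ≤ x → |d.mu x| + |d.sigma x| ≤ C * (1 + x)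
  mu_contDiff : ContDiffOn ℝ 1 d.mu (Ici 0)
  sigma_contDiff : ContDiffOn ℝ 1 d.sigma (Ici 0)
  mu_lipschitz : ∃ C, LipschitzOnWith C d.mu (Ici 0)
  sigma_lipschitz : ∃ C, LipschitzOnWith C d.sigma (Ici 0)
  mu_deriv_lipschitz : ∃ C, LipschitzOnWith C (halfLineDeriv d.mu) (Ici 0)
  sigma_deriv_lipschitz : ∃ C, LipschitzOnWith C (halfLineDeriv d.sigma) (Ici 0)
  sigma_sq_pos : ∀ x, 0 ≤ x → 0 < d.sigma x ^ 2
  xlam_nonneg : 0 ≤ d.xlam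
  lam_lt_mu_deriv : ∀ x, 0 ≤ x → x < d.xlam → d.lam < halfLineDeriv d.mu x
  mu_deriv_le_lam : ∀ x, d.xlam ≤ x → halfLineDeriv d.mu x ≤ d.lam

/-- The generator `L f = (1/2) sigma^2 f'' + mu f' - lam f`. -/
def L (d : DividendModel) (f : ℝ → ℝ) (x : ℝ) : ℝ :=
  1 / 2 * d.sigma x ^ 2 * halfLineDeriv (halfLineDeriv f) x + d.mu x * halfLineDeriv f x
    - d.lam * f x

/-- `f` is a twice continuously differentiable solution of `L f = 0` on `[0, ∞)`. -/
def IsSolution (d : DividendModel) (f : ℝ → ℝ) : Prop :=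
  ContDiffOn ℝ 2 f (Ici 0) ∧ ∀ x, 0 ≤ x → d.L f x = 0

/-- The choice of the two solutions: `g1` is the solution with value `1` at `0` and vanishing
derivative at `xlam`; `g2` is a strictly increasing solution with value `1` at `0`. -/
structure SolutionPair (d : DividendModel) : Prop where
  g1_sol : d.IsSolution d.g1
  g1_zero : d.g1 0 = 1
  g1_deriv_xlam : halfLineDeriv d.g1 d.xlam = 0
  g2_sol : d.IsSolution d.g2
  g2_zero : d.g2 0 = 1
  g2_strictMono : StrictMonoOn d.g2 (Ici 0)
  g2_deriv_zero : 0 < halfLineDeriv d.g2 0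

/-- The family `g(x; β) = g2(x) - β g1(x)`. -/
def gb (d : DividendModel) (β x : ℝ) : ℝ := d.g2 x - β * d.g1 x

/-- The canonical solution `g = g2 - g1`. -/
def g (d : DividendModel) (x : ℝ) : ℝ := d.gb 1 x

/-- The derivative of `g(x; β)` in `x`. -/
def dgb (d : DividendModel) (β x : ℝ) : ℝ := halfLineDeriv (d.gb β) x

/-- The derivative of the canonical solution. -/
def dg (d : DividendModel) (x : ℝ) : ℝ := halfLineDeriv d.g x

/-- `I(a, b, c) = ∫_a^b (k - c g'(x)) dx`. -/
def I (d : DividendModel) (a b c : ℝ) : ℝ := d.k * (b - a) - c * (d.g b - d.g a)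

/-- The set `C₁` of admissible coefficients with a positive lower barrier. -/
def C1 (d : DividendModel) : Set ℝ :=
  {c | 0 < c ∧ ∃ u w : ℝ, 0 < u ∧ u < w ∧ c * d.dg u = d.k ∧ c * d.dg w = d.k ∧ d.I u w c = d.K}

/-- The set `C₂` of admissible coefficients with lower barrier `0`. -/
def C2 (d : DividendModel) : Set ℝ :=
  {c | 0 < c ∧ ∃ w : ℝ, 0 < w ∧ c * d.dg w = d.k ∧ c * d.dg 0 < d.k ∧ d.I 0 w c = d.K}

/-- The set `U` of points where `cstar * g'` equals `k`. -/
def U (d : DividendModel) : Set ℝ := {u | 0 ≤ u ∧ d.cstar * d.dg u = d.k}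

/-- `cstar`, `ubar` and `ulow` are the maximal coefficient, the maximal upper barrier for it,
and the maximal lower barrier for these two. -/
structure BarrierData (d : DividendModel) : Prop where
  cstar_max : IsGreatest (d.C1 ∪ d.C2) d.cstar
  ubar_max : IsGreatest
    {w | w ∈ d.U ∧ ∃ u ∈ insert 0 d.U, u < w ∧ d.I u w d.cstar = d.K} d.ubar
  ulow_max : IsGreatest
    {u | u ∈ insert 0 d.U ∧ u < d.ubar ∧ d.I u d.ubar d.cstar = d.K} d.ulow

/-- Case R with finite `x2`: the canonical solution is convex on `[0, x1)`, concave on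
`[x1, x2)` and convex on `[x2, ∞)`. -/
structure CaseR (d : DividendModel) : Prop where
  x1_pos : 0 < d.x1
  x1_le_xlam : d.x1 ≤ d.xlam
  xlam_le_x2 : d.xlam ≤ d.x2
  convex_left : ConvexOn ℝ (Ico 0 d.x1) d.g
  concave_middle : ConcaveOn ℝ (Ico d.x1 d.x2) d.g
  convex_right : ConvexOn ℝ (Ici d.x2) d.g

/-- Subcase R5. -/
def R5 (d : DividendModel) : Prop :=
  d.CaseR ∧ d.BarrierData ∧ 0 = d.ulow ∧ d.ulow < d.ubar ∧ d.ubar < d.x1 ∧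
    d.k ≤ d.cstar * d.dg d.x2

/-- Subcase R6. -/
def R6 (d : DividendModel) : Prop :=
  d.CaseR ∧ d.BarrierData ∧ 0 = d.ulow ∧ d.ulow < d.ubar ∧ d.ubar < d.x1 ∧
    d.cstar * d.dg d.x2 < d.k

/-- The function `x ↦ mu(x) k - lam (k x - K)`. -/
def m (d : DividendModel) (x : ℝ) : ℝ := d.mu x * d.k - d.lam * (d.k * x - d.K)

/-- All assumptions of the first of the two problems, for the chosen solutions `g1`, `g2`. -/
structure Problem1 (d : DividendModel) : Prop where
  coeff : d.CoefficientAssumptions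
  sols : d.SolutionPair
  case : d.R5 ∨ d.R6
  m_xlam_pos : 0 < d.m d.xlam

/-- The unique zero in `(x1, xlam)` of the function `m`. -/
def zlow (d : DividendModel) : ℝ := Function.invFunOn d.m (Ioo d.x1 d.xlam) 0

/-- `γ(β, x) = k (g(x; β) / g'(x; β) - x) + K`. -/
def gamma (d : DividendModel) (β x : ℝ) : ℝ := d.k * (d.gb β x / d.dgb β x - x) + d.K

/-- `h = g2'' / g1''`. -/
def h (d : DividendModel) (x : ℝ) : ℝ :=
  halfLineDeriv (halfLineDeriv d.g2) x / halfLineDeriv (halfLineDeriv d.g1) x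

/-- The limit of `h` at infinity, which may be infinite (`h` is monotone on `(xlam, ∞)`). -/
def hInf (d : DividendModel) : EReal := liminf (fun x : ℝ => ((d.h x : ℝ) : EReal)) atTop

/-- The inverse of `h` on `[x1, xlam]`. -/
def hMinusInv (d : DividendModel) (β : ℝ) : ℝ := Function.invFunOn d.h (Icc d.x1 d.xlam) β

/-- The (right) inverse of `h` on `[xlam, ∞)`. -/
def hPlusInv (d : DividendModel) (β : ℝ) : ℝ := Function.invFunOn d.h (Ici d.xlam) β

/-- `u₁(β)`: the unique zero of `γ(β, ·)` in `[ubar, zlow]`, for `β ∈ [h(zlow), 1]`. -/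
def u1 (d : DividendModel) (β : ℝ) : ℝ := Function.invFunOn (d.gamma β) (Icc d.ubar d.zlow) 0

open Classical in
/-- `v(β) = g'(hPlusInv β; β) / g'(u₁(β); β)` where `hPlusInv` is defined, else `∞`. -/
def v (d : DividendModel) (β : ℝ) : EReal :=
  if β ∈ Icc (d.h d.zlow) 1 ∧ (β : EReal) < d.hInf then
    ((d.dgb β (d.hPlusInv β) / d.dgb β (d.u1 β) : ℝ) : EReal)
  else ⊤

/-- `β₀ = sup {β₁ ∈ (h(zlow), 1] : v ≤ 1 on (h(zlow), β₁]}`. -/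
def beta0 (d : DividendModel) : ℝ :=
  sSup {b | b ∈ Ioc (d.h d.zlow) 1 ∧ ∀ β ∈ Ioc (d.h d.zlow) b, d.v β ≤ 1}

/-- `G(β) = lim_{x → ∞} g'(x; β) / g'(u₁(β); β)`, which may be infinite (`g'(·; β)` is
eventually monotone, so that the limit exists). -/
def G (d : DividendModel) (β : ℝ) : EReal :=
  liminf (fun x : ℝ => ((d.dgb β x / d.dgb β (d.u1 β) : ℝ) : EReal)) atTop

/-- `a` is the number `α₀`. It need not exist. -/
def IsAlpha0 (d : DividendModel) (a : ℝ) : Prop :=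
  (1 ≤ d.G (d.h d.zlow) ∧ a = d.h d.zlow) ∨
    (d.G (d.h d.zlow) < 1 ∧ a ∈ Ioo (d.h d.zlow) d.beta0 ∧ d.G a = 1)

/-- `u₂(β)`: the point between `hMinusInv β` and `hPlusInv β` where `g'(·; β)` has the same
value as at `u₁(β)`. -/
def u2 (d : DividendModel) (β : ℝ) : ℝ :=
  Function.invFunOn (d.dgb β) (Ioo (d.hMinusInv β) (d.hPlusInv β)) (d.dgb β (d.u1 β))

/-- `u₃(β)`: the point beyond `hPlusInv β` where `g'(·; β)` has the same value as at `u₁(β)`. -/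
def u3 (d : DividendModel) (β : ℝ) : ℝ :=
  Function.invFunOn (d.dgb β) (Ioi (d.hPlusInv β)) (d.dgb β (d.u1 β))

/-- `J(β, a, b) = k (b - a - (g(b; β) - g(a; β)) / g'(b; β))`. -/
def J (d : DividendModel) (β a b : ℝ) : ℝ :=
  d.k * (b - a - (d.gb β b - d.gb β a) / d.dgb β b)

/-- The limit of `J(β, u₂(β), u₃(β))` as `β` decreases to `a`. -/
def J2lim (d : DividendModel) (a : ℝ) : EReal :=
  liminf (fun β : ℝ => ((d.J β (d.u2 β) (d.u3 β) : ℝ) : EReal)) (𝓝[>] a)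

/-- The limit of `J(β, u₁(β), u₃(β))` as `β` decreases to `a`. -/
def J13lim (d : DividendModel) (a : ℝ) : EReal :=
  liminf (fun β : ℝ => ((d.J β (d.u1 β) (d.u3 β) : ℝ) : EReal)) (𝓝[>] a)

/-- Case G1. -/
def G1 (d : DividendModel) : Prop := 1 ≤ d.G (d.h d.zlow)

/-- Case G2, where `a` is the number `α₀`. -/
def G2 (d : DividendModel) (a : ℝ) : Prop := d.G (d.h d.zlow) < 1 ∧ 0 ≤ d.J13lim a

/-- Case G3, where `a` is the number `α₀`. -/
def G3 (d : DividendModel) (a : ℝ) : Prop :=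
  d.G (d.h d.zlow) < 1 ∧ d.J13lim a < 0 ∧ (d.K : EReal) < d.J2lim a

end DividendModel

end

/-!
The whole family `g(·; β)` is studied through its tangency point `u = u1 β`, the point where the
tangent to `g(·; β)` passes through `(K / k, 0)`. The map `β ↦ u1 β` is inverse to an explicit
strictly decreasing function (`betaOf`), and `g(·; β) / g'(u; β)` is the solution `Phi u` of
`L f = 0` with `f(u) = u - K / k`, `f'(u) = 1`, which is explicit in `u` by means of the Wronskian
of `g1` and `g2`. Its `u`-derivative has the sign of `m(u)`, negative to the left of `zlow`, so for
fixed `x ≥ u` both `Phi u x` and its slope `dPhi u x` decrease strictly in `u` (`dPhi_lt`), that is,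
increase in `β`. All monotonicity in `β` (of `v`, `u2`, `u3`, `J`) comes from this.

The shape of solutions is read off `curv`, the second derivative times a positive weight: its
derivative has the sign of `(lam - μ') f'`, so where `f' > 0` it decreases strictly up to
`xlam` and is nondecreasing afterwards. Hence the slope of `Phi u` rises from `1` at `u` to a maximum at `h₋⁻¹(β)`,
falls to a minimum at `h₊⁻¹(β)` and rises again (`crossings_of_eq_one`). The minimum is below `1`
for `β < β₀`, and the limit at infinity is above `1` for `β > α₀`; the latter is strict because the
difference of two normalized solutions has slope bounded away from `0` (`exists_slope_bound`).
So `u2` and `u3` exist, and they are continuous in `u` (`crossings_cont`).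

With `E x = x - K / k - Phi u x` (`excess`) one has `J₁₂ = k E(u2)`, `J₁₃ = k E(u3)` and
`J₂₃ = k (E(u3) - E(u2))`. Both alternatives of the conclusion together say that
`max (J₁₃, J₂₃ - K) = 0`, and the intermediate value theorem gives such a `β` once the maximum
is positive near `α₀` and negative near `β₀`. Near `α₀` this is the case distinction G1, G2, G3
(`exists_near_alpha0`). Near `β₀` (`exists_near_beta0`) either the slope of the limiting
solution is at least `1` throughout, or `β₀ = 1` and `u1 = ubar`; in the second case the sign comes
from the maximality of `cstar` and `ubar` (`I_le_K`). In case G3, `J₁₃` is negative on the whole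
interval, since it decreases in `β`, which leaves the second alternative only.
-/

noncomputable section

namespace DividendModel

variable {d : DividendModel}

/-! ### The weighted second derivative of a solution -/

/-- `f` is a solution of `L f = 0` on `[0, ∞)` with derivative `p`; the derivatives are only
asked for in the open half line, which together with continuity is all that is used. -/
structure Sol (d : DividendModel) (f p : ℝ → ℝ) : Prop where
  cont : ContinuousOn f (Ici 0)
  contDeriv : ContinuousOn p (Ici 0)
  hasDeriv : ∀ x, 0 < x → HasDerivAt f (p x) x
  hasDeriv2 : ∀ x, 0 < x →
    HasDerivAt p ((d.lam * f x - d.mu x * p x) / (d.sigma x ^ 2 / 2)) x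

/-- The integrating factor `exp (∫₀ˣ 2 μ / σ²)`; the integrand is frozen to the left of `0`, so
that it is continuous on the whole line. -/
def intFactor (d : DividendModel) (x : ℝ) : ℝ :=
  Real.exp (∫ t in (0 : ℝ)..x, d.mu (max t 0) / (d.sigma (max t 0) ^ 2 / 2))

/-- The weighted second derivative `intFactor * (σ² / 2) * f''` of a solution `f` with derivative
`p`, written without second derivatives by means of `L f = 0`. -/
def curv (d : DividendModel) (f p : ℝ → ℝ) (x : ℝ) : ℝ :=
  d.intFactor x * (d.lam * f x - d.mu x * p x)

lemma hasDerivAt_halfLineDeriv {f : ℝ → ℝ} (hf : DifferentiableOn ℝ f (Ici 0)) {x : ℝ}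
    (hx : 0 < x) : HasDerivAt f (halfLineDeriv f x) x :=
  ((hf x hx.le).hasDerivWithinAt).hasDerivAt (Ici_mem_nhds hx)

lemma IsSolution.sol (hc : d.CoefficientAssumptions) {f : ℝ → ℝ} (hf : d.IsSolution f) :
    d.Sol f (halfLineDeriv f) := by
  have h1 : ContDiffOn ℝ 1 (halfLineDeriv f) (Ici 0) :=
    hf.1.derivWithin (uniqueDiffOn_Ici 0) (by norm_num)
  refine ⟨hf.1.continuousOn, h1.continuousOn, fun x hx =>
    hasDerivAt_halfLineDeriv (hf.1.differentiableOn (by norm_num)) hx, fun x hx => ?_⟩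
  have h2 := hasDerivAt_halfLineDeriv (h1.differentiableOn (by norm_num)) hx
  have h3 := hf.2 x hx.le
  have h4 := hc.sigma_sq_pos x hx.le
  convert h2 using 1
  rw [div_eq_iff (by positivity)]
  unfold L at h3
  linarith

lemma Sol.comb {f₁ p₁ f₂ p₂ : ℝ → ℝ} (h₁ : d.Sol f₁ p₁) (h₂ : d.Sol f₂ p₂) (a b : ℝ) :
    d.Sol (fun x => a * f₁ x + b * f₂ x) (fun x => a * p₁ x + b * p₂ x) := by
  refine ⟨(h₁.cont.const_mul a).add (h₂.cont.const_mul b),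
    (h₁.contDeriv.const_mul a).add (h₂.contDeriv.const_mul b), fun x hx =>
    ((h₁.hasDeriv x hx).const_mul a).add ((h₂.hasDeriv x hx).const_mul b), fun x hx => ?_⟩
  exact (((h₁.hasDeriv2 x hx).const_mul a).add ((h₂.hasDeriv2 x hx).const_mul b)).congr_deriv
    (by ring)

lemma intFactor_pos (d : DividendModel) (x : ℝ) : 0 < d.intFactor x := Real.exp_pos _

lemma intFactor_zero (d : DividendModel) : d.intFactor 0 = 1 := by simp [intFactor]

namespace CoefficientAssumptions

lemma mu_cont (hc : d.CoefficientAssumptions) : ContinuousOn d.mu (Ici 0) :=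
  hc.mu_contDiff.continuousOn

lemma mu_hasDerivAt (hc : d.CoefficientAssumptions) {x : ℝ} (hx : 0 < x) :
    HasDerivAt d.mu (halfLineDeriv d.mu x) x :=
  hasDerivAt_halfLineDeriv (hc.mu_contDiff.differentiableOn (by norm_num)) hx

lemma half_sq_pos (hc : d.CoefficientAssumptions) {x : ℝ} (hx : 0 ≤ x) :
    0 < d.sigma x ^ 2 / 2 := half_pos (hc.sigma_sq_pos x hx)

lemma intFactor_hasDerivAt_aux (hc : d.CoefficientAssumptions) (x : ℝ) :
    HasDerivAt d.intFactor
      (d.intFactor x * (d.mu (max x 0) / (d.sigma (max x 0) ^ 2 / 2))) x := by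
  have hmax : Continuous fun t : ℝ => max t 0 := by fun_prop
  have hm : Continuous fun t : ℝ => d.mu (max t 0) :=
    hc.mu_cont.comp_continuous hmax fun t => le_max_right t 0
  have hs : Continuous fun t : ℝ => d.sigma (max t 0) :=
    hc.sigma_contDiff.continuousOn.comp_continuous hmax fun t => le_max_right t 0
  have hq : Continuous fun t : ℝ => d.mu (max t 0) / (d.sigma (max t 0) ^ 2 / 2) :=
    hm.div₀ ((hs.pow 2).div_const 2) fun t => (hc.half_sq_pos (le_max_right t 0)).ne'
  exact (intervalIntegral.integral_hasDerivAt_right (hq.intervalIntegrable _ _)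
    (hq.stronglyMeasurableAtFilter _ _) hq.continuousAt).exp

lemma intFactor_hasDerivAt (hc : d.CoefficientAssumptions) {x : ℝ} (hx : 0 < x) :
    HasDerivAt d.intFactor (d.intFactor x * (d.mu x / (d.sigma x ^ 2 / 2))) x := by
  simpa [max_eq_left hx.le] using hc.intFactor_hasDerivAt_aux x

lemma intFactor_cont (hc : d.CoefficientAssumptions) : Continuous d.intFactor :=
  continuous_iff_continuousAt.2 fun x => (hc.intFactor_hasDerivAt_aux x).continuousAt

end CoefficientAssumptions

namespace Sol

variable {f p : ℝ → ℝ}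

lemma curv_hasDerivAt (hc : d.CoefficientAssumptions) (hf : d.Sol f p) {x : ℝ} (hx : 0 < x) :
    HasDerivAt (d.curv f p)
      (d.intFactor x * (d.lam - halfLineDeriv d.mu x) * p x) x := by
  have hs := (hc.half_sq_pos hx.le).ne'
  have := (hc.intFactor_hasDerivAt hx).mul (((hf.hasDeriv x hx).const_mul d.lam).sub
    ((hc.mu_hasDerivAt hx).mul (hf.hasDeriv2 x hx)))
  refine this.congr_deriv ?_
  simp only [Pi.sub_apply, Pi.mul_apply]
  field_simp
  ring

lemma curv_cont (hc : d.CoefficientAssumptions) (hf : d.Sol f p) :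
    ContinuousOn (d.curv f p) (Ici 0) :=
  hc.intFactor_cont.continuousOn.mul
    ((hf.cont.const_mul _).sub (hc.mu_cont.mul hf.contDeriv))

/-- The second derivative of a solution in terms of its weighted second derivative. -/
lemma deriv_hasDerivAt_curv (hf : d.Sol f p) {x : ℝ} (hx : 0 < x) :
    HasDerivAt p (d.curv f p x / (d.intFactor x * (d.sigma x ^ 2 / 2))) x := by
  convert hf.hasDeriv2 x hx using 1
  unfold curv
  rw [mul_div_mul_left _ _ (d.intFactor_pos x).ne']

lemma weight_pos (hc : d.CoefficientAssumptions) {x : ℝ} (hx : 0 ≤ x) :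
    0 < d.intFactor x * (d.sigma x ^ 2 / 2) := mul_pos (d.intFactor_pos x) (hc.half_sq_pos hx)

lemma curv_strictAntiOn (hc : d.CoefficientAssumptions) (hf : d.Sol f p) {a b : ℝ} (ha : 0 ≤ a)
    (hb : b ≤ d.xlam) (hp : ∀ x ∈ Ioo a b, 0 < p x) : StrictAntiOn (d.curv f p) (Icc a b) := by
  refine strictAntiOn_of_deriv_neg (convex_Icc a b)
    ((hf.curv_cont hc).mono fun x hx => ha.trans hx.1) fun x hx => ?_
  rw [interior_Icc] at hx
  have hx0 : 0 < x := ha.trans_lt hx.1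
  rw [(hf.curv_hasDerivAt hc hx0).deriv]
  have := hc.lam_lt_mu_deriv x hx0.le (hx.2.trans_le hb)
  exact mul_neg_of_neg_of_pos (mul_neg_of_pos_of_neg (d.intFactor_pos x) (by linarith)) (hp x hx)

lemma curv_monotoneOn (hc : d.CoefficientAssumptions) (hf : d.Sol f p)
    (hp : ∀ x, d.xlam < x → 0 < p x) : MonotoneOn (d.curv f p) (Ici d.xlam) := by
  have h0 := hc.xlam_nonneg
  refine monotoneOn_of_deriv_nonneg (convex_Ici _)
    ((hf.curv_cont hc).mono fun x hx => h0.trans hx) (fun x hx => ?_) fun x hx => ?_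
  all_goals
    rw [interior_Ici] at hx
    have hx0 : 0 < x := h0.trans_lt hx
  · exact (hf.curv_hasDerivAt hc hx0).differentiableAt.differentiableWithinAt
  rw [(hf.curv_hasDerivAt hc hx0).deriv]
  have := hc.mu_deriv_le_lam x (le_of_lt hx)
  exact mul_nonneg (mul_nonneg (d.intFactor_pos x).le (by linarith)) (hp x hx).le

section shape
variable {s : Set ℝ}

lemma strictMonoOn_of_curv_pos (hc : d.CoefficientAssumptions) (hf : d.Sol f p)
    (hs : Convex ℝ s) (hs0 : s ⊆ Ici 0) (h : ∀ x ∈ interior s, 0 < x → 0 < d.curv f p x) :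
    StrictMonoOn p s := by
  refine strictMonoOn_of_deriv_pos hs (hf.contDeriv.mono hs0) fun x hx => ?_
  have hx0 : 0 < x := by simpa [interior_Ici] using interior_mono hs0 hx
  rw [(hf.deriv_hasDerivAt_curv hx0).deriv]
  exact div_pos (h x hx hx0) (weight_pos hc hx0.le)

lemma strictAntiOn_of_curv_neg (hc : d.CoefficientAssumptions) (hf : d.Sol f p)
    (hs : Convex ℝ s) (hs0 : s ⊆ Ici 0) (h : ∀ x ∈ interior s, 0 < x → d.curv f p x < 0) :
    StrictAntiOn p s := by
  refine strictAntiOn_of_deriv_neg hs (hf.contDeriv.mono hs0) fun x hx => ?_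
  have hx0 : 0 < x := by simpa [interior_Ici] using interior_mono hs0 hx
  rw [(hf.deriv_hasDerivAt_curv hx0).deriv]
  exact div_neg_of_neg_of_pos (h x hx hx0) (weight_pos hc hx0.le)

lemma monotoneOn_of_curv_nonneg (hc : d.CoefficientAssumptions) (hf : d.Sol f p)
    (hs : Convex ℝ s) (hs0 : s ⊆ Ici 0) (h : ∀ x ∈ interior s, 0 < x → 0 ≤ d.curv f p x) :
    MonotoneOn p s := by
  have h0 : ∀ x ∈ interior s, 0 < x := fun x hx => by
    simpa [interior_Ici] using interior_mono hs0 hx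
  refine monotoneOn_of_deriv_nonneg hs (hf.contDeriv.mono hs0) (fun x hx =>
    (hf.hasDeriv2 x (h0 x hx)).differentiableAt.differentiableWithinAt) fun x hx => ?_
  rw [(hf.deriv_hasDerivAt_curv (h0 x hx)).deriv]
  exact div_nonneg (h x hx (h0 x hx)) (weight_pos hc (h0 x hx).le).le

lemma antitoneOn_of_curv_nonpos (hc : d.CoefficientAssumptions) (hf : d.Sol f p)
    (hs : Convex ℝ s) (hs0 : s ⊆ Ici 0) (h : ∀ x ∈ interior s, 0 < x → d.curv f p x ≤ 0) :
    AntitoneOn p s := by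
  have h0 : ∀ x ∈ interior s, 0 < x := fun x hx => by
    simpa [interior_Ici] using interior_mono hs0 hx
  refine antitoneOn_of_deriv_nonpos hs (hf.contDeriv.mono hs0) (fun x hx =>
    (hf.hasDeriv2 x (h0 x hx)).differentiableAt.differentiableWithinAt) fun x hx => ?_
  rw [(hf.deriv_hasDerivAt_curv (h0 x hx)).deriv]
  exact div_nonpos_of_nonpos_of_nonneg (h x hx (h0 x hx)) (weight_pos hc (h0 x hx).le).le

end shape

lemma mul_hasDerivAt (hc : d.CoefficientAssumptions) (hf : d.Sol f p) {x : ℝ} (hx : 0 < x) :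
    HasDerivAt (fun x => d.intFactor x * (f x * p x))
      (d.intFactor x * (p x ^ 2 + d.lam / (d.sigma x ^ 2 / 2) * f x ^ 2)) x := by
  have hs := (hc.half_sq_pos hx.le).ne'
  refine ((hc.intFactor_hasDerivAt hx).mul
    ((hf.hasDeriv x hx).mul (hf.hasDeriv2 x hx))).congr_deriv ?_
  simp only [Pi.mul_apply]
  field_simp
  ring

lemma mul_cont (hc : d.CoefficientAssumptions) (hf : d.Sol f p) :
    ContinuousOn (fun x => d.intFactor x * (f x * p x)) (Ici 0) :=
  hc.intFactor_cont.continuousOn.mul (hf.cont.mul hf.contDeriv)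

/-- `intFactor * f * f'` increases strictly wherever `f` is not the zero solution: its derivative
is a positive combination of `f ^ 2` and `f' ^ 2`. -/
lemma mul_lt (hc : d.CoefficientAssumptions) (hf : d.Sol f p) {a b : ℝ} (ha : 0 ≤ a)
    (hab : a < b) (hne : ∀ x ∈ Ioo a b, f x ≠ 0 ∨ p x ≠ 0) :
    d.intFactor a * (f a * p a) < d.intFactor b * (f b * p b) := by
  have : StrictMonoOn (fun x => d.intFactor x * (f x * p x)) (Icc a b) := by
    refine strictMonoOn_of_deriv_pos (convex_Icc a b)
      ((hf.mul_cont hc).mono fun x hx => ha.trans hx.1) fun x hx => ?_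
    rw [interior_Icc] at hx
    have hx0 : 0 < x := ha.trans_lt hx.1
    rw [(hf.mul_hasDerivAt hc hx0).deriv]
    refine mul_pos (d.intFactor_pos x) ?_
    have h1 : 0 < d.lam / (d.sigma x ^ 2 / 2) := div_pos hc.lam_pos (hc.half_sq_pos hx0.le)
    rcases hne x hx with h | h
    · have : 0 < f x ^ 2 := by positivity
      positivity
    · have : 0 < p x ^ 2 := by positivity
      positivity
  exact this (left_mem_Icc.2 hab.le) (right_mem_Icc.2 hab.le) hab

lemma mul_le (hc : d.CoefficientAssumptions) (hf : d.Sol f p) {a b : ℝ} (ha : 0 ≤ a)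
    (hab : a ≤ b) : d.intFactor a * (f a * p a) ≤ d.intFactor b * (f b * p b) := by
  have : MonotoneOn (fun x => d.intFactor x * (f x * p x)) (Ici 0) := by
    refine monotoneOn_of_deriv_nonneg (convex_Ici 0) (hf.mul_cont hc) (fun x hx => ?_)
      fun x hx => ?_
    all_goals rw [interior_Ici] at hx
    · exact (hf.mul_hasDerivAt hc hx).differentiableAt.differentiableWithinAt
    rw [(hf.mul_hasDerivAt hc hx).deriv]
    have h1 : 0 < d.lam / (d.sigma x ^ 2 / 2) :=
      div_pos hc.lam_pos (hc.half_sq_pos (le_of_lt hx))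
    have := d.intFactor_pos x
    positivity
  exact this ha (ha.trans hab) hab

/-- The weighted Wronskian of two solutions is constant. -/
lemma wronskian_const (hc : d.CoefficientAssumptions) {f₁ p₁ f₂ p₂ : ℝ → ℝ} (h₁ : d.Sol f₁ p₁)
    (h₂ : d.Sol f₂ p₂) {x : ℝ} (hx : 0 ≤ x) :
    d.intFactor x * (p₂ x * f₁ x - p₁ x * f₂ x) = p₂ 0 * f₁ 0 - p₁ 0 * f₂ 0 := by
  have hcont : ContinuousOn (fun x => d.intFactor x * (p₂ x * f₁ x - p₁ x * f₂ x)) (Icc 0 x) :=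
    (hc.intFactor_cont.continuousOn.mul
      ((h₂.contDeriv.mul h₁.cont).sub (h₁.contDeriv.mul h₂.cont))).mono fun y hy => hy.1
  rcases hx.eq_or_lt with rfl | hx'
  · rw [intFactor_zero, one_mul]
  -- the mean value theorem on `[0, x]`, with vanishing derivative inside
  obtain ⟨y, hy, hy'⟩ := exists_hasDerivAt_eq_slope
    (fun x => d.intFactor x * (p₂ x * f₁ x - p₁ x * f₂ x)) (fun _ => 0) hx' hcont
    fun y hy => by
      have hs := (hc.half_sq_pos hy.1.le).ne'
      refine ((hc.intFactor_hasDerivAt hy.1).mul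
        (((h₂.hasDeriv2 y hy.1).mul (h₁.hasDeriv y hy.1)).sub
          ((h₁.hasDeriv2 y hy.1).mul (h₂.hasDeriv y hy.1)))).congr_deriv ?_
      simp only [Pi.mul_apply, Pi.sub_apply]
      field_simp
      ring
  rw [eq_div_iff (by linarith), zero_mul] at hy'
  simp only [intFactor_zero, one_mul] at hy'
  linarith

/-- A solution that is nonnegative and nondecreasing at a point, and not zero there to first
order, is positive and strictly increasing from then on. -/
lemma pos_of_nonneg (hc : d.CoefficientAssumptions) (hf : d.Sol f p) {a : ℝ} (ha : 0 ≤ a)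
    (hfa : 0 ≤ f a) (hpa : 0 ≤ p a) (hne : f a ≠ 0 ∨ p a ≠ 0) {x : ℝ} (hx : a < x) :
    0 < f x ∧ 0 < p x := by
  have hIci : Ici a ⊆ Ici (0 : ℝ) := fun y hy => ha.trans hy
  have key : ∀ y, a < y → 0 < f y * p y := by
    intro y hy
    -- near `a` the solution does not vanish to first order
    have hev : ∀ᶠ t in 𝓝[>] a, f t ≠ 0 ∨ p t ≠ 0 := by
      rcases hne with h | h
      · exact (((hf.cont a ha).mono hIci).eventually_ne h).filter_mono
          (nhdsWithin_mono _ Ioi_subset_Ici_self) |>.mono fun t ht => Or.inl ht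
      · exact (((hf.contDeriv a ha).mono hIci).eventually_ne h).filter_mono
          (nhdsWithin_mono _ Ioi_subset_Ici_self) |>.mono fun t ht => Or.inr ht
    obtain ⟨b, hb, hb'⟩ := mem_nhdsGT_iff_exists_Ioo_subset.1 hev
    have hab : a < min b y := lt_min hb hy
    have h1 := hf.mul_lt hc ha hab fun t ht => hb' ⟨ht.1, ht.2.trans_le (min_le_left _ _)⟩
    have h2 := hf.mul_le hc (ha.trans hab.le) (min_le_right b y)
    have h3 : 0 ≤ d.intFactor a * (f a * p a) :=
      mul_nonneg (d.intFactor_pos a).le (mul_nonneg hfa hpa)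
    exact (pos_iff_pos_of_mul_pos (h3.trans_lt (h1.trans_le h2))).1 (d.intFactor_pos y)
  have hpne : ∀ y, a < y → p y ≠ 0 := fun y hy h => by simpa [h] using key y hy
  suffices hp : 0 < p x from ⟨(pos_iff_pos_of_mul_pos (key x hx)).2 hp, hp⟩
  by_contra hcon
  have hpx : p x < 0 := lt_of_le_of_ne (not_lt.1 hcon) (hpne x hx)
  have hneg : ∀ y, a < y → p y < 0 := by
    intro y hy
    by_contra hy'
    have hpre : IsPreconnected (Ioi a) := isPreconnected_Ioi
    obtain ⟨t, ht, ht0⟩ := hpre.intermediate_value (a := x) (b := y) hx hy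
      (hf.contDeriv.mono fun t ht => ha.trans (le_of_lt ht)) ⟨hpx.le, not_lt.1 hy'⟩
    exact hpne t ht ht0
  have hfneg : ∀ y, a < y → f y < 0 := fun y hy => by nlinarith [key y hy, hneg y hy]
  have hle : ∀ q : ℝ → ℝ, ContinuousOn q (Ici 0) → (∀ y, a < y → q y < 0) → q a ≤ 0 :=
    fun q hq h => le_of_tendsto (((hq a ha).mono hIci).tendsto.mono_left
      (nhdsWithin_mono a Ioi_subset_Ici_self))
      (eventually_nhdsWithin_of_forall fun y hy => (h y hy).le)
  rcases hne with h | h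
  · exact h (le_antisymm (hle f hf.cont hfneg) hfa)
  · exact h (le_antisymm (hle p hf.contDeriv hneg) hpa)

/-- A positive, strictly increasing solution has slope bounded away from `0`: either it is
eventually convex, or it dominates a positive multiple of the affine majorant
`μ(xlam) + lam (x - xlam)` of the drift. -/
lemma exists_slope_bound (hc : d.CoefficientAssumptions) (hf : d.Sol f p)
    (hpos : ∀ x, d.xlam ≤ x → 0 < f x ∧ 0 < p x) :
    ∃ δ > 0, ∀ x, d.xlam ≤ x → δ ≤ p x := by
  have h0 := hc.xlam_nonneg
  have hmono := hf.curv_monotoneOn hc fun x hx => (hpos x hx.le).2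
  by_cases hex : ∃ x₀, d.xlam ≤ x₀ ∧ 0 ≤ d.curv f p x₀
  · obtain ⟨x₀, hx₀, hcx⟩ := hex
    obtain ⟨y, hy, hmin⟩ := isCompact_Icc.exists_isMinOn (nonempty_Icc.2 hx₀)
      (hf.contDeriv.mono fun t (ht : t ∈ Icc d.xlam x₀) => h0.trans ht.1)
    refine ⟨p y, (hpos y hy.1).2, fun x hx => ?_⟩
    rcases le_total x x₀ with h | h
    · exact hmin ⟨hx, h⟩
    · refine le_trans (hmin (right_mem_Icc.2 hx₀)) ?_
      refine hf.monotoneOn_of_curv_nonneg hc (convex_Ici x₀) (fun t ht => h0.trans (hx₀.trans ht))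
        (fun t ht _ => ?_) self_mem_Ici h h
      rw [interior_Ici] at ht
      exact hcx.trans (hmono hx₀ (hx₀.trans (le_of_lt ht)) (le_of_lt ht))
  · push Not at hex
    set n : ℝ → ℝ := fun x => d.mu d.xlam + d.lam * (x - d.xlam) with hn
    have hmun : ∀ x, d.xlam ≤ x → d.mu x ≤ n x := by
      have : AntitoneOn (fun x => d.mu x - d.lam * x) (Ici d.xlam) := by
        refine antitoneOn_of_deriv_nonpos (convex_Ici _) ((hc.mu_cont.mono fun x hx =>
          h0.trans hx).sub (by fun_prop)) (fun x hx => ?_) fun x hx => ?_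
        all_goals
          rw [interior_Ici] at hx
          have hd := (hc.mu_hasDerivAt (h0.trans_lt hx)).sub
            ((hasDerivAt_id x).const_mul d.lam)
        · exact hd.differentiableAt.differentiableWithinAt
        · have := hc.mu_deriv_le_lam x (le_of_lt hx)
          have hd' : deriv (fun x => d.mu x - d.lam * x) x = _ := hd.deriv
          rw [hd']
          linarith
      intro x hx
      have := this self_mem_Ici hx hx
      simp only [hn] at this ⊢
      linarith
    have hlt : ∀ x, d.xlam ≤ x → d.lam * f x < n x * p x := by
      intro x hx
      have h1 := hex x hx
      have h2 : d.lam * f x - d.mu x * p x < 0 := by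
        by_contra h
        exact absurd h1 (not_lt.2 (mul_nonneg (d.intFactor_pos x).le (not_lt.1 h)))
      nlinarith [hmun x hx, (hpos x hx).2]
    have hnpos : ∀ x, d.xlam ≤ x → 0 < n x := by
      intro x hx
      have := hlt x hx
      have h2 := mul_pos hc.lam_pos (hpos x hx).1
      exact (pos_iff_pos_of_mul_pos (h2.trans this)).2 (hpos x hx).2
    have hratio : MonotoneOn (fun x => f x / n x) (Ici d.xlam) := by
      have hd : ∀ x, d.xlam < x → HasDerivAt (fun x => f x / n x)
          ((p x * n x - f x * d.lam) / n x ^ 2) x := by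
        intro x hx
        have hnd : HasDerivAt n d.lam x := 
          ((((hasDerivAt_id x).sub_const d.xlam).const_mul d.lam).const_add
            (d.mu d.xlam)).congr_deriv (mul_one _)
        exact (hf.hasDeriv x (h0.trans_lt hx)).div hnd (hnpos x hx.le).ne'
      refine monotoneOn_of_deriv_nonneg (convex_Ici _) ((hf.cont.mono fun x hx => h0.trans hx).div
        (by simp only [hn]; fun_prop) fun x hx => (hnpos x hx).ne') (fun x hx => ?_) fun x hx => ?_
      all_goals rw [interior_Ici] at hx
      · exact (hd x hx).differentiableAt.differentiableWithinAt
      · rw [(hd x hx).deriv]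
        have := hlt x (le_of_lt hx)
        exact div_nonneg (by linarith) (sq_nonneg _)
    refine ⟨d.lam * (f d.xlam / n d.xlam), mul_pos hc.lam_pos
      (div_pos (hpos _ le_rfl).1 (hnpos _ le_rfl)), fun x hx => ?_⟩
    have h1 : f d.xlam / n d.xlam ≤ f x / n x := hratio self_mem_Ici hx hx
    have h2 : d.lam * (f x / n x) < p x := by
      rw [← mul_div_assoc, div_lt_iff₀ (hnpos x hx)]
      linarith [hlt x hx]
    exact (mul_le_mul_of_nonneg_left h1 hc.lam_pos.le).trans h2.le

end Sol

/-! ### The solutions `g1`, `g2` and the functions `h` and `m` -/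

namespace Sol
variable {f p : ℝ → ℝ}

lemma curv_nonneg_of_convexOn (hc : d.CoefficientAssumptions) (hf : d.Sol f p) {s : Set ℝ}
    (hs : ConvexOn ℝ s f) {x : ℝ} (hx : 0 < x) (hxs : s ∈ 𝓝 x) : 0 ≤ d.curv f p x := by
  by_contra! hneg
  have hcont : ContinuousAt (d.curv f p) x := (hf.curv_cont hc).continuousAt (Ici_mem_nhds hx)
  obtain ⟨l, u, hlu, hsub⟩ := mem_nhds_iff_exists_Ioo_subset.1
    (inter_mem (inter_mem (hcont.eventually_lt_const hneg) hxs) (Ioi_mem_nhds hx))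
  have hanti : StrictAntiOn p (Ioo l u) := hf.strictAntiOn_of_curv_neg hc (convex_Ioo l u)
    (fun t ht => mem_Ici.2 (le_of_lt (hsub ht).2)) fun t ht _ => (hsub (interior_subset ht)).1.1
  have hcv : ConvexOn ℝ (Ioo l u) f := hs.subset (fun t ht => (hsub ht).1.2) (convex_Ioo l u)
  have hmono := hcv.monotoneOn_deriv fun t ht => (hf.hasDeriv t (hsub ht).2).differentiableAt
  obtain ⟨t, ht⟩ := exists_between hlu.2
  have htm : t ∈ Ioo l u := ⟨hlu.1.trans ht.1, ht.2⟩
  have h1 := hmono hlu htm ht.1.le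
  rw [(hf.hasDeriv x hx).deriv, (hf.hasDeriv t (hsub htm).2).deriv] at h1
  exact absurd (hanti hlu htm ht.1) (not_lt.2 h1)

lemma neg (hf : d.Sol f p) : d.Sol (fun x => -f x) (fun x => -p x) := by
  simpa using hf.comb hf (-1) 0

lemma curv_nonpos_of_concaveOn (hc : d.CoefficientAssumptions) (hf : d.Sol f p) {s : Set ℝ}
    (hs : ConcaveOn ℝ s f) {x : ℝ} (hx : 0 < x) (hxs : s ∈ 𝓝 x) : d.curv f p x ≤ 0 := by
  have := hf.neg.curv_nonneg_of_convexOn hc hs.neg hx hxs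
  unfold curv at this ⊢
  linarith

end Sol

/-- The value of the constant weighted Wronskian of `g1` and `g2`. -/
def wron (d : DividendModel) : ℝ := halfLineDeriv d.g2 0 - halfLineDeriv d.g1 0

lemma curv_comb (d : DividendModel) (f₁ p₁ f₂ p₂ : ℝ → ℝ) (a b x : ℝ) :
    d.curv (fun x => a * f₁ x + b * f₂ x) (fun x => a * p₁ x + b * p₂ x) x =
      a * d.curv f₁ p₁ x + b * d.curv f₂ p₂ x := by
  unfold curv; ring

lemma curv_g (d : DividendModel) (x : ℝ) :
    d.curv d.g (fun x => halfLineDeriv d.g2 x - halfLineDeriv d.g1 x) x =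
    d.curv d.g2 (halfLineDeriv d.g2) x - d.curv d.g1 (halfLineDeriv d.g1) x := by
  simp only [curv, g, gb]; ring

namespace Problem1
variable (hP : d.Problem1)
include hP

lemma caseR : d.CaseR := by rcases hP.case with h | h <;> exact h.1

lemma barrierData : d.BarrierData := by rcases hP.case with h | h <;> exact h.2.1

lemma ubar_lt_x1 : d.ubar < d.x1 := by
  rcases hP.case with h | h <;> exact h.2.2.2.2.1

lemma ulow_eq : d.ulow = 0 := by
  rcases hP.case with h | h <;> exact h.2.2.1.symm

lemma ubar_pos : 0 < d.ubar := by
  rw [← hP.ulow_eq]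
  rcases hP.case with h | h <;> exact h.2.2.2.1

lemma xlam_pos : 0 < d.xlam := hP.caseR.x1_pos.trans_le hP.caseR.x1_le_xlam

lemma sol1 : d.Sol d.g1 (halfLineDeriv d.g1) := hP.sols.g1_sol.sol hP.coeff

lemma sol2 : d.Sol d.g2 (halfLineDeriv d.g2) := hP.sols.g2_sol.sol hP.coeff

lemma wronskian {x : ℝ} (hx : 0 ≤ x) :
    d.intFactor x * (halfLineDeriv d.g2 x * d.g1 x - halfLineDeriv d.g1 x * d.g2 x) = d.wron := by
  rw [hP.sol1.wronskian_const hP.coeff hP.sol2 hx, hP.sols.g1_zero, hP.sols.g2_zero, wron]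
  ring

lemma g1_deriv_zero_nonpos : halfLineDeriv d.g1 0 ≤ 0 := by
  have := hP.sol1.mul_le hP.coeff le_rfl hP.xlam_pos.le
  simpa [intFactor_zero, hP.sols.g1_zero, hP.sols.g1_deriv_xlam] using this

lemma wron_pos : 0 < d.wron := by
  have := hP.g1_deriv_zero_nonpos
  have := hP.sols.g2_deriv_zero
  unfold wron; linarith

/-- `g1` never vanishes to first order, since its Wronskian with `g2` is not zero. -/
lemma g1_ne {x : ℝ} (hx : 0 ≤ x) : d.g1 x ≠ 0 ∨ halfLineDeriv d.g1 x ≠ 0 := by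
  by_contra! h
  have := hP.wronskian hx
  rw [h.1, h.2] at this
  have := hP.wron_pos
  simp_all

lemma g1_mul_deriv_neg {x : ℝ} (hx : 0 ≤ x) (hx' : x < d.xlam) :
    d.g1 x * halfLineDeriv d.g1 x < 0 := by
  have := hP.sol1.mul_lt hP.coeff hx hx' fun t ht => hP.g1_ne (hx.trans ht.1.le)
  rw [hP.sols.g1_deriv_xlam, mul_zero, mul_zero] at this
  exact (pos_iff_neg_of_mul_neg this).1 (d.intFactor_pos x)

lemma g1_pos_left {x : ℝ} (hx : 0 ≤ x) (hx' : x ≤ d.xlam) : 0 < d.g1 x := by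
  have hne : ∀ t, 0 ≤ t → t ≤ d.xlam → d.g1 t ≠ 0 := by
    intro t ht ht' h
    rcases ht'.eq_or_lt with rfl | hlt
    · rcases hP.g1_ne ht with h1 | h1
      · exact h1 h
      · exact h1 hP.sols.g1_deriv_xlam
    · have := hP.g1_mul_deriv_neg ht hlt
      simp [h] at this
  by_contra! hcon
  obtain ⟨t, ht, ht0⟩ := intermediate_value_Icc' hx
    (hP.sol1.cont.mono fun t (ht : t ∈ Icc 0 x) => ht.1) (show (0 : ℝ) ∈ Icc (d.g1 x) (d.g1 0) from
      ⟨hcon, by rw [hP.sols.g1_zero]; exact zero_le_one⟩)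
  exact hne t ht.1 (ht.2.trans hx') ht0

lemma g1_deriv_neg {x : ℝ} (hx : 0 ≤ x) (hx' : x < d.xlam) : halfLineDeriv d.g1 x < 0 :=
  (pos_iff_neg_of_mul_neg (hP.g1_mul_deriv_neg hx hx')).1 (hP.g1_pos_left hx hx'.le)

lemma g1_deriv_nonpos {x : ℝ} (hx : 0 ≤ x) (hx' : x ≤ d.xlam) : halfLineDeriv d.g1 x ≤ 0 := by
  rcases hx'.eq_or_lt with rfl | h
  · exact hP.sols.g1_deriv_xlam.le
  · exact (hP.g1_deriv_neg hx h).le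

lemma g1_pos_right {x : ℝ} (hx : d.xlam < x) : 0 < d.g1 x ∧ 0 < halfLineDeriv d.g1 x := by
  have h := hP.g1_pos_left hP.xlam_pos.le le_rfl
  exact hP.sol1.pos_of_nonneg hP.coeff hP.xlam_pos.le h.le hP.sols.g1_deriv_xlam.ge
    (Or.inl h.ne') hx

lemma g1_pos {x : ℝ} (hx : 0 ≤ x) : 0 < d.g1 x := by
  rcases le_or_gt x d.xlam with h | h
  · exact hP.g1_pos_left hx h
  · exact (hP.g1_pos_right h).1

lemma solg : d.Sol d.g (fun x => halfLineDeriv d.g2 x - halfLineDeriv d.g1 x) := by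
  convert hP.sol2.comb hP.sol1 1 (-1) using 2
  · simp [g, gb]; ring
  · ring

lemma g_zero : d.g 0 = 0 := by simp [g, gb, hP.sols.g1_zero, hP.sols.g2_zero]

lemma g_pos {x : ℝ} (hx : 0 < x) :
    0 < d.g x ∧ 0 < halfLineDeriv d.g2 x - halfLineDeriv d.g1 x :=
  hP.solg.pos_of_nonneg hP.coeff le_rfl hP.g_zero.ge hP.wron_pos.le (Or.inr hP.wron_pos.ne') hx

lemma dgb_eq (β : ℝ) {x : ℝ} (hx : 0 ≤ x) :
    d.dgb β x = halfLineDeriv d.g2 x - β * halfLineDeriv d.g1 x := by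
  have hu := uniqueDiffOn_Ici (0 : ℝ) x hx
  have h1 := ((hP.sols.g1_sol.1.differentiableOn (by norm_num)) x hx).hasDerivWithinAt
  have h2 := ((hP.sols.g2_sol.1.differentiableOn (by norm_num)) x hx).hasDerivWithinAt
  exact (h2.sub (h1.const_mul β)).derivWithin hu

lemma dg_eq {x : ℝ} (hx : 0 ≤ x) :
    d.dg x = halfLineDeriv d.g2 x - halfLineDeriv d.g1 x := by
  have : d.dg x = d.dgb 1 x := rfl
  rw [this, hP.dgb_eq 1 hx, one_mul]

lemma cstar_pos : 0 < d.cstar := by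
  rcases hP.barrierData.cstar_max.1 with h | h <;> exact h.1

lemma cstar_mul_dg : d.cstar * d.dg d.ubar = d.k := hP.barrierData.ubar_max.1.1.2

lemma I_zero_ubar : d.I 0 d.ubar d.cstar = d.K := by
  have := hP.barrierData.ulow_max.1.2.2
  rwa [hP.ulow_eq] at this

lemma K_lt : d.K / d.k < d.ubar := by
  have h := hP.I_zero_ubar
  rw [I, hP.g_zero] at h
  rw [div_lt_iff₀ hP.coeff.k_pos]
  have := mul_pos hP.cstar_pos (hP.g_pos hP.ubar_pos).1
  linarith

/-- The tangent to `g` at `ubar` passes through the point `(K / k, 0)`. -/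
lemma g_ubar : d.g d.ubar = (d.ubar - d.K / d.k) *
    (halfLineDeriv d.g2 d.ubar - halfLineDeriv d.g1 d.ubar) := by
  have h := hP.I_zero_ubar
  have h2 := hP.cstar_mul_dg
  rw [I, hP.g_zero] at h
  rw [hP.dg_eq hP.ubar_pos.le] at h2
  have hk := hP.coeff.k_pos
  have hc := hP.cstar_pos
  apply mul_left_cancel₀ hc.ne'
  have h3 : d.K / d.k * d.k = d.K := div_mul_cancel₀ _ hk.ne'
  linear_combination (d.K / d.k - d.ubar) * h2 - h + h3

lemma curv_g_strictAntiOn :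
    StrictAntiOn (d.curv d.g (fun x => halfLineDeriv d.g2 x - halfLineDeriv d.g1 x))
      (Icc 0 d.xlam) :=
  hP.solg.curv_strictAntiOn hP.coeff le_rfl le_rfl fun _ hx => (hP.g_pos hx.1).2

lemma curv_g_x1_nonneg :
    0 ≤ d.curv d.g (fun x => halfLineDeriv d.g2 x - halfLineDeriv d.g1 x) d.x1 := by
  have hx := hP.caseR.x1_pos
  have hcont := ((hP.solg.curv_cont hP.coeff) d.x1 hx.le).continuousAt (Ici_mem_nhds hx)
  refine ge_of_tendsto (hcont.tendsto.mono_left (nhdsWithin_le_nhds (s := Iio d.x1))) ?_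
  filter_upwards [Ioo_mem_nhdsLT hx] with t ht
  exact hP.solg.curv_nonneg_of_convexOn hP.coeff hP.caseR.convex_left ht.1
    (Ico_mem_nhds ht.1 ht.2)

lemma curv_g_pos {x : ℝ} (hx : 0 ≤ x) (hx1 : x < d.x1) :
    0 < d.curv d.g (fun x => halfLineDeriv d.g2 x - halfLineDeriv d.g1 x) x :=
  hP.curv_g_x1_nonneg.trans_lt (hP.curv_g_strictAntiOn ⟨hx, hx1.le.trans hP.caseR.x1_le_xlam⟩
    ⟨hP.caseR.x1_pos.le, hP.caseR.x1_le_xlam⟩ hx1)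

/-- As long as `g` is convex, its tangents meet the axis to the right of `K / k`. -/
lemma g_lt_tangent {x : ℝ} (hx : d.ubar < x)
    (hcv : ∀ t ∈ Ioo d.ubar x,
      0 < d.curv d.g (fun x => halfLineDeriv d.g2 x - halfLineDeriv d.g1 x) t) :
    d.g x < (x - d.K / d.k) * (halfLineDeriv d.g2 x - halfLineDeriv d.g1 x) := by
  have h0 := hP.ubar_pos
  have hsub : Icc d.ubar x ⊆ Ici 0 := fun t ht => h0.le.trans ht.1
  have hmono : StrictAntiOn (fun t => d.g t -
      (t - d.K / d.k) * (halfLineDeriv d.g2 t - halfLineDeriv d.g1 t)) (Icc d.ubar x) := by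
    refine strictAntiOn_of_deriv_neg (convex_Icc _ _) ((hP.solg.cont.mono hsub).sub
      (ContinuousOn.mul (by fun_prop) (hP.solg.contDeriv.mono hsub))) fun t ht => ?_
    rw [interior_Icc] at ht
    have ht0 := h0.trans ht.1
    have hd := (hP.solg.hasDeriv t ht0).sub (((hasDerivAt_id t).sub_const (d.K / d.k)).mul
      (hP.solg.deriv_hasDerivAt_curv ht0))
    have h1 := div_pos (hcv t ht) (Sol.weight_pos hP.coeff ht0.le)
    have h2 : 0 < t - d.K / d.k := by linarith [hP.K_lt, ht.1]
    have hd' := hd.deriv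
    refine (hd'.trans_lt ?_ : deriv (fun t => d.g t -
      (t - d.K / d.k) * (halfLineDeriv d.g2 t - halfLineDeriv d.g1 t)) t < 0)
    have := mul_pos h2 h1
    simp only [id]
    linarith
  have := hmono (left_mem_Icc.2 hx.le) (right_mem_Icc.2 hx.le) hx
  have h3 := hP.g_ubar
  simp only at this
  linarith

/-- If `x1 = xlam`, then `g` would be convex on `[0, xlam]`, and `L g = 0` would contradict
`m(xlam) > 0`. -/
lemma x1_lt_xlam : d.x1 < d.xlam := by
  refine lt_of_le_of_ne hP.caseR.x1_le_xlam fun heq => ?_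
  have hk := hP.coeff.k_pos
  have h1 := hP.g_lt_tangent (heq ▸ hP.ubar_lt_x1) fun t ht =>
    hP.curv_g_pos (hP.ubar_pos.le.trans ht.1.le) (heq ▸ ht.2)
  have h2 := hP.curv_g_x1_nonneg
  rw [heq, curv] at h2
  have h3 := (mul_nonneg_iff_of_pos_left (d.intFactor_pos _)).1 h2
  have h4 := hP.m_xlam_pos
  unfold m at h4
  have h5 := (hP.g_pos hP.xlam_pos).2
  have h6 : d.lam * (d.xlam - d.K / d.k) < d.mu d.xlam := by
    have : d.lam * (d.xlam - d.K / d.k) * d.k = d.lam * (d.k * d.xlam - d.K) := by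
      field_simp
    nlinarith
  nlinarith [mul_lt_mul_of_pos_left h1 hP.coeff.lam_pos, mul_lt_mul_of_pos_right h6 h5]

/-- Since `x1 < xlam ≤ x2`, there is a genuine interval of concavity to the right of `x1`. -/
lemma curv_g_x1 :
    d.curv d.g (fun x => halfLineDeriv d.g2 x - halfLineDeriv d.g1 x) d.x1 = 0 := by
  refine le_antisymm ?_ hP.curv_g_x1_nonneg
  have hx := hP.caseR.x1_pos
  have hcont := ((hP.solg.curv_cont hP.coeff) d.x1 hx.le).continuousAt (Ici_mem_nhds hx)
  refine le_of_tendsto (hcont.tendsto.mono_left (nhdsWithin_le_nhds (s := Ioi d.x1))) ?_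
  filter_upwards [Ioo_mem_nhdsGT (hP.x1_lt_xlam.trans_le hP.caseR.xlam_le_x2)] with t ht
  exact hP.solg.curv_nonpos_of_concaveOn hP.coeff hP.caseR.concave_middle (hx.trans ht.1)
    (Ico_mem_nhds ht.1 ht.2)

lemma curv_g_x2_nonneg {x : ℝ} (hx : d.x2 < x) :
    0 ≤ d.curv d.g (fun x => halfLineDeriv d.g2 x - halfLineDeriv d.g1 x) x :=
  hP.solg.curv_nonneg_of_convexOn hP.coeff hP.caseR.convex_right
    (hP.xlam_pos.trans_le (hP.caseR.xlam_le_x2.trans hx.le)) (Ici_mem_nhds hx)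

lemma curv_g1_monotone : MonotoneOn (d.curv d.g1 (halfLineDeriv d.g1)) (Ici d.xlam) :=
  hP.sol1.curv_monotoneOn hP.coeff fun _ hx => (hP.g1_pos_right hx).2

lemma mu_x1_pos : 0 < d.mu d.x1 := by
  have h := hP.curv_g_x1
  rw [curv, mul_eq_zero] at h
  have h1 := h.resolve_left (d.intFactor_pos _).ne'
  have h2 := hP.g_pos hP.caseR.x1_pos
  have h3 := mul_pos hP.coeff.lam_pos h2.1
  have h4 : 0 < d.mu d.x1 * (halfLineDeriv d.g2 d.x1 - halfLineDeriv d.g1 d.x1) := by linarith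
  exact (pos_iff_pos_of_mul_pos h4).2 h2.2

/-- `g1` is convex to the right of `x1`. -/
lemma curv_g1_pos {x : ℝ} (hx : d.x1 ≤ x) : 0 < d.curv d.g1 (halfLineDeriv d.g1) x := by
  have hxl := hP.x1_lt_xlam
  have h0 := hP.caseR.x1_pos
  have hl : ∀ t, d.x1 ≤ t → t ≤ d.xlam → 0 < d.curv d.g1 (halfLineDeriv d.g1) t := by
    intro t ht htl
    -- `mu` increases on `[0, xlam]`, hence stays positive to the right of `x1`
    have hmu : MonotoneOn d.mu (Icc d.x1 d.xlam) := by
      refine monotoneOn_of_deriv_nonneg (convex_Icc _ _)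
        (hP.coeff.mu_cont.mono fun t ht => h0.le.trans ht.1) (fun x hx => ?_) fun x hx => ?_
      all_goals
        rw [interior_Icc] at hx
        have hd := hP.coeff.mu_hasDerivAt (h0.trans hx.1)
      · exact hd.differentiableAt.differentiableWithinAt
      · rw [hd.deriv]
        exact (hP.coeff.lam_pos.trans
          (hP.coeff.lam_lt_mu_deriv x (h0.trans hx.1).le hx.2)).le
    have h1 := hP.mu_x1_pos.trans_le (hmu (left_mem_Icc.2 hxl.le) ⟨ht, htl⟩ ht)
    have h2 := mul_pos hP.coeff.lam_pos (hP.g1_pos (h0.le.trans ht))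
    have h3 := mul_nonpos_of_nonneg_of_nonpos h1.le (hP.g1_deriv_nonpos (h0.le.trans ht) htl)
    exact mul_pos (d.intFactor_pos t) (by linarith)
  rcases le_total x d.xlam with h | h
  · exact hl x hx h
  · exact (hl d.xlam hxl.le le_rfl).trans_le (hP.curv_g1_monotone self_mem_Ici h h)

lemma deriv2_eq {f : ℝ → ℝ} (hf : d.IsSolution f) {x : ℝ} (hx : 0 ≤ x) :
    halfLineDeriv (halfLineDeriv f) x =
      d.curv f (halfLineDeriv f) x / (d.intFactor x * (d.sigma x ^ 2 / 2)) := by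
  have h3 := hf.2 x hx
  have h4 := hP.coeff.half_sq_pos hx
  unfold curv
  rw [mul_div_mul_left _ _ (d.intFactor_pos x).ne', eq_div_iff h4.ne']
  unfold L at h3
  linarith

lemma h_eq {x : ℝ} (hx : 0 ≤ x) :
    d.h x = d.curv d.g2 (halfLineDeriv d.g2) x / d.curv d.g1 (halfLineDeriv d.g1) x := by
  rw [h, hP.deriv2_eq hP.sols.g1_sol hx, hP.deriv2_eq hP.sols.g2_sol hx,
    div_div_div_cancel_right₀ (Sol.weight_pos hP.coeff hx).ne']

lemma h_cont : ContinuousOn d.h (Ici d.x1) := by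
  have h0 := hP.caseR.x1_pos
  have : ContinuousOn (fun x => d.curv d.g2 (halfLineDeriv d.g2) x /
      d.curv d.g1 (halfLineDeriv d.g1) x) (Ici d.x1) :=
    ((hP.sol2.curv_cont hP.coeff).mono fun x hx => h0.le.trans hx).div
      ((hP.sol1.curv_cont hP.coeff).mono fun x hx => h0.le.trans hx)
      fun x hx => (hP.curv_g1_pos hx).ne'
  exact this.congr fun x hx => hP.h_eq (h0.le.trans hx)

/-- On `[x1, xlam]` the function `h` decreases strictly: its derivative is the Wronskian times
a negative factor. -/
lemma h_strictAntiOn : StrictAntiOn d.h (Icc d.x1 d.xlam) := by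
  have h0 := hP.caseR.x1_pos
  refine strictAntiOn_of_deriv_neg (convex_Icc _ _)
    (hP.h_cont.mono fun x hx => hx.1) fun x hx => ?_
  rw [interior_Icc] at hx
  have hx0 := h0.trans hx.1
  have hpos := hP.curv_g1_pos hx.1.le
  have hd := (hP.sol2.curv_hasDerivAt hP.coeff hx0).div
    (hP.sol1.curv_hasDerivAt hP.coeff hx0) hpos.ne'
  have heq : d.h =ᶠ[𝓝 x] (d.curv d.g2 (halfLineDeriv d.g2) / d.curv d.g1 (halfLineDeriv d.g1)) := by
    filter_upwards [Ioi_mem_nhds hx0] with t ht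
    exact hP.h_eq (le_of_lt ht)
  rw [heq.deriv_eq, hd.deriv]
  refine div_neg_of_neg_of_pos ?_ (by positivity)
  have hw := hP.wronskian hx0.le
  have hwp := hP.wron_pos
  have hl := hP.coeff.lam_lt_mu_deriv x hx0.le hx.2
  have hA := d.intFactor_pos x
  have : d.intFactor x * (d.lam - halfLineDeriv d.mu x) * halfLineDeriv d.g2 x *
        d.curv d.g1 (halfLineDeriv d.g1) x -
      d.curv d.g2 (halfLineDeriv d.g2) x *
        (d.intFactor x * (d.lam - halfLineDeriv d.mu x) * halfLineDeriv d.g1 x) =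
      -(d.intFactor x * (halfLineDeriv d.mu x - d.lam) * d.lam * d.wron) := by
    rw [← hw]; unfold curv; ring
  rw [this]
  have := mul_pos (mul_pos (mul_pos hA (sub_pos.2 hl)) hP.coeff.lam_pos) hwp
  linarith

lemma h_eq_one_add {x : ℝ} (hx : d.x1 ≤ x) : d.h x = 1 +
    d.curv d.g (fun x => halfLineDeriv d.g2 x - halfLineDeriv d.g1 x) x /
      d.curv d.g1 (halfLineDeriv d.g1) x := by
  have := (hP.curv_g1_pos hx).ne'
  rw [hP.h_eq (hP.caseR.x1_pos.le.trans hx), curv_g]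
  field_simp
  ring

lemma h_x1 : d.h d.x1 = 1 := by rw [hP.h_eq_one_add le_rfl, hP.curv_g_x1]; simp

lemma one_le_h {x : ℝ} (hx : d.x2 < x) : 1 ≤ d.h x := by
  have hx1 : d.x1 ≤ x := (hP.x1_lt_xlam.le.trans hP.caseR.xlam_le_x2).trans hx.le
  rw [hP.h_eq_one_add hx1]
  have := div_nonneg (hP.curv_g_x2_nonneg hx) (hP.curv_g1_pos hx1).le
  linarith

lemma one_le_hInf : (1 : EReal) ≤ d.hInf := by
  refine le_liminf_of_le (by isBoundedDefault) ?_
  filter_upwards [eventually_gt_atTop d.x2] with x hx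
  exact_mod_cast hP.one_le_h hx

lemma m_strictMonoOn : StrictMonoOn d.m (Icc 0 d.xlam) := by
  refine strictMonoOn_of_deriv_pos (convex_Icc _ _)
    (((hP.coeff.mu_cont.mono fun x hx => hx.1).mul_const _).sub (by fun_prop)) fun x hx => ?_
  rw [interior_Icc] at hx
  have hd : HasDerivAt d.m (halfLineDeriv d.mu x * d.k - d.lam * d.k) x :=
    (((hP.coeff.mu_hasDerivAt hx.1).mul_const d.k).sub
      ((((hasDerivAt_id x).const_mul d.k).sub_const d.K).const_mul d.lam)).congr_deriv (by simp)
  rw [hd.deriv]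
  have := mul_lt_mul_of_pos_right (hP.coeff.lam_lt_mu_deriv x hx.1.le hx.2) hP.coeff.k_pos
  linarith

lemma m_cont : ContinuousOn d.m (Ici 0) := (hP.coeff.mu_cont.mul_const _).sub (by fun_prop)

lemma m_eq (x : ℝ) : d.m x = d.k * (d.mu x - d.lam * (x - d.K / d.k)) := by
  have := hP.coeff.k_pos.ne'
  unfold m
  field_simp

lemma m_x1_neg : d.m d.x1 < 0 := by
  have h1 := hP.g_lt_tangent hP.ubar_lt_x1 fun t ht =>
    hP.curv_g_pos (hP.ubar_pos.le.trans ht.1.le) ht.2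
  have h := hP.curv_g_x1
  rw [curv, mul_eq_zero] at h
  have h2 := h.resolve_left (d.intFactor_pos _).ne'
  have h3 := (hP.g_pos hP.caseR.x1_pos).2
  rw [hP.m_eq]
  refine mul_neg_of_pos_of_neg hP.coeff.k_pos ?_
  have h4 := mul_lt_mul_of_pos_left h1 hP.coeff.lam_pos
  by_contra! hcon
  have := mul_le_mul_of_nonneg_right hcon h3.le
  linarith

lemma zlow_mem : d.zlow ∈ Ioo d.x1 d.xlam ∧ d.m d.zlow = 0 := by
  have hl := hP.x1_lt_xlam
  obtain ⟨z, hz, hz0⟩ := intermediate_value_Ioo hl.le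
    (hP.m_cont.mono fun x hx => hP.caseR.x1_pos.le.trans hx.1) ⟨hP.m_x1_neg, hP.m_xlam_pos⟩
  exact ⟨Function.invFunOn_mem ⟨z, hz, hz0⟩, Function.invFunOn_eq ⟨z, hz, hz0⟩⟩

lemma zlow_pos : 0 < d.zlow := hP.caseR.x1_pos.trans hP.zlow_mem.1.1

lemma m_neg {x : ℝ} (hx : 0 ≤ x) (hxz : x < d.zlow) : d.m x < 0 := by
  have hz := hP.zlow_mem
  rw [← hz.2]
  exact hP.m_strictMonoOn ⟨hx, hxz.le.trans hz.1.2.le⟩ ⟨hP.zlow_pos.le, hz.1.2.le⟩ hxz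

lemma ubar_lt_zlow : d.ubar < d.zlow := hP.ubar_lt_x1.trans hP.zlow_mem.1.1

end Problem1

/-! ### Normalized solutions and the tangency point `u1` -/

/-- `f(u) - (u - K / k) f'(u)`, which vanishes when the tangent to `f` at `u` passes through the
point `(K / k, 0)`; for `f = g(·; β)` this is the numerator of `γ(β, u)`, up to the factor `k`. -/
def tangentGap (d : DividendModel) (f p : ℝ → ℝ) (u : ℝ) : ℝ := f u - (u - d.K / d.k) * p u

/-- The parameter `β` for which the tangent to `g(·; β)` at `u` passes through `(K / k, 0)`, that
is, the inverse of `u1`. -/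
def betaOf (d : DividendModel) (u : ℝ) : ℝ :=
  d.tangentGap d.g2 (halfLineDeriv d.g2) u / d.tangentGap d.g1 (halfLineDeriv d.g1) u

/-- The solution of `L f = 0` with `f(u) = u - K / k` and `f'(u) = 1`, in the variable `x`. It is
`g(·; β)` divided by `g'(u; β)`, with `β = betaOf u`. -/
def Phi (d : DividendModel) (u x : ℝ) : ℝ :=
  d.intFactor u * d.tangentGap d.g1 (halfLineDeriv d.g1) u / d.wron * d.g2 x +
    -(d.intFactor u * d.tangentGap d.g2 (halfLineDeriv d.g2) u / d.wron) * d.g1 x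

/-- The derivative of `Phi` in its second variable. -/
def dPhi (d : DividendModel) (u x : ℝ) : ℝ :=
  d.intFactor u * d.tangentGap d.g1 (halfLineDeriv d.g1) u / d.wron * halfLineDeriv d.g2 x +
    -(d.intFactor u * d.tangentGap d.g2 (halfLineDeriv d.g2) u / d.wron) * halfLineDeriv d.g1 x

lemma Sol.tangentGap_hasDerivAt (hc : d.CoefficientAssumptions) {f p : ℝ → ℝ} (hf : d.Sol f p)
    {u : ℝ} (hu : 0 < u) : HasDerivAt (fun u => d.intFactor u * d.tangentGap f p u)
      (d.intFactor u * d.m u / (d.sigma u ^ 2 / 2 * d.k) * f u) u := by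
  have hs := (hc.half_sq_pos hu.le).ne'
  have hk := hc.k_pos.ne'
  refine ((hc.intFactor_hasDerivAt hu).mul ((hf.hasDeriv u hu).sub
    (((hasDerivAt_id u).sub_const (d.K / d.k)).mul (hf.hasDeriv2 u hu)))).congr_deriv ?_
  simp only [Pi.mul_apply, Pi.sub_apply, id, m]
  field_simp
  ring

lemma Sol.tangentGap_cont {f p : ℝ → ℝ} (hf : d.Sol f p) :
    ContinuousOn (d.tangentGap f p) (Ici 0) :=
  hf.cont.sub (ContinuousOn.mul (by fun_prop) hf.contDeriv)

namespace Problem1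
variable (hP : d.Problem1)
include hP

lemma solPhi (u : ℝ) : d.Sol (d.Phi u) (d.dPhi u) := hP.sol2.comb hP.sol1 _ _

lemma Phi_self {u : ℝ} (hu : 0 ≤ u) : d.Phi u u = u - d.K / d.k := by
  have hw := hP.wronskian hu
  have h0 := hP.wron_pos.ne'
  unfold Phi tangentGap
  rw [← sub_eq_zero]
  field_simp
  rw [← hw]
  have hk := hP.coeff.k_pos.ne'
  field_simp
  ring

lemma dPhi_self {u : ℝ} (hu : 0 ≤ u) : d.dPhi u u = 1 := by
  have hw := hP.wronskian hu
  have h0 := hP.wron_pos.ne'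
  unfold dPhi tangentGap
  rw [← sub_eq_zero]
  field_simp
  rw [← hw]
  have hk := hP.coeff.k_pos.ne'
  field_simp
  ring

lemma gap1_pos {u : ℝ} (hu : d.ubar ≤ u) (hux : u ≤ d.xlam) :
    0 < d.tangentGap d.g1 (halfLineDeriv d.g1) u := by
  have h0 := hP.ubar_pos.le.trans hu
  have h1 := hP.g1_pos h0
  have h2 := hP.g1_deriv_nonpos h0 hux
  have h3 := hP.K_lt
  unfold tangentGap
  nlinarith

lemma Phi_coeff_pos {u : ℝ} (hu : u ∈ Icc d.ubar d.zlow) :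
    0 < d.intFactor u * d.tangentGap d.g1 (halfLineDeriv d.g1) u / d.wron :=
  div_pos (mul_pos (d.intFactor_pos u) (hP.gap1_pos hu.1 (hu.2.trans hP.zlow_mem.1.2.le)))
    hP.wron_pos

lemma Phi_pos {u x : ℝ} (hu : d.ubar ≤ u) (hx : u ≤ x) : 0 < d.Phi u x ∧ 0 < d.dPhi u x := by
  have h0 := hP.ubar_pos.le.trans hu
  have h1 := hP.Phi_self h0
  have h2 := hP.dPhi_self h0
  have h3 := hP.K_lt
  rcases hx.eq_or_lt with rfl | hx
  · exact ⟨by linarith, by linarith⟩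
  · exact (hP.solPhi u).pos_of_nonneg hP.coeff h0 (by linarith) (by linarith)
      (Or.inr (by rw [h2]; exact one_ne_zero)) hx

lemma cross_pos {u x : ℝ} (hu : 0 ≤ u) (hx : u < x) :
    0 < d.g1 u * d.g2 x - d.g2 u * d.g1 x ∧
      0 < d.g1 u * halfLineDeriv d.g2 x - d.g2 u * halfLineDeriv d.g1 x := by
  have hs := hP.sol2.comb hP.sol1 (d.g1 u) (-d.g2 u)
  have h1 : 0 < d.g1 u * halfLineDeriv d.g2 u + -d.g2 u * halfLineDeriv d.g1 u := by
    have hw := hP.wronskian hu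
    have h2 : 0 < d.intFactor u *
        (halfLineDeriv d.g2 u * d.g1 u - halfLineDeriv d.g1 u * d.g2 u) := hw ▸ hP.wron_pos
    have := (pos_iff_pos_of_mul_pos h2).1 (d.intFactor_pos u)
    linarith
  have := hs.pos_of_nonneg hP.coeff hu (by simp [mul_comm]) h1.le (Or.inr h1.ne') hx
  exact ⟨by linarith [this.1], by linarith [this.2]⟩

/-- Monotonicity of the normalized solutions in the tangency point. The derivative of
`intFactor * tangentGap` contains the factor `m`, which is negative to the left of `zlow`. -/
lemma Phi_strictAntiOn (x : ℝ) :
    StrictAntiOn (fun u => d.Phi u x) (Icc d.ubar (min x d.zlow)) ∧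
      StrictAntiOn (fun u => d.dPhi u x) (Icc d.ubar (min x d.zlow)) := by
  have h0 := hP.ubar_pos
  have key : ∀ a b : ℝ, (∀ u, 0 ≤ u → u < x → 0 < d.g1 u * a - d.g2 u * b) →
      StrictAntiOn (fun u =>
        d.intFactor u * d.tangentGap d.g1 (halfLineDeriv d.g1) u / d.wron * a +
          -(d.intFactor u * d.tangentGap d.g2 (halfLineDeriv d.g2) u / d.wron) * b)
        (Icc d.ubar (min x d.zlow)) := by
    intro a b hab
    refine strictAntiOn_of_deriv_neg (convex_Icc _ _) ?_ fun u hu => ?_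
    · have hA := hP.coeff.intFactor_cont.continuousOn (s := Icc d.ubar (min x d.zlow))
      have h1 := hP.sol1.tangentGap_cont.mono
        fun t (ht : t ∈ Icc d.ubar (min x d.zlow)) => h0.le.trans ht.1
      have h2 := hP.sol2.tangentGap_cont.mono
        fun t (ht : t ∈ Icc d.ubar (min x d.zlow)) => h0.le.trans ht.1
      exact (((hA.mul h1).div_const _).mul_const a).add
        (((hA.mul h2).div_const _).neg.mul_const b)
    · rw [interior_Icc] at hu
      have hu0 := h0.trans hu.1
      have hux := hu.2.trans_le (min_le_left _ _)
      have hd := (((hP.sol1.tangentGap_hasDerivAt hP.coeff hu0).div_const d.wron).mul_const a).add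
        (((hP.sol2.tangentGap_hasDerivAt hP.coeff hu0).div_const d.wron).neg.mul_const b)
      refine (hd.deriv.trans_lt ?_ : deriv (fun u =>
        d.intFactor u * d.tangentGap d.g1 (halfLineDeriv d.g1) u / d.wron * a +
          -(d.intFactor u * d.tangentGap d.g2 (halfLineDeriv d.g2) u / d.wron) * b) u < 0)
      have hm := hP.m_neg hu0.le (hu.2.trans_le (min_le_right _ _))
      have hs := mul_pos (hP.coeff.half_sq_pos hu0.le) hP.coeff.k_pos
      have hneg : d.intFactor u * d.m u / (d.sigma u ^ 2 / 2 * d.k) / d.wron < 0 :=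
        div_neg_of_neg_of_pos (div_neg_of_neg_of_pos
          (mul_neg_of_pos_of_neg (d.intFactor_pos u) hm) hs) hP.wron_pos
      have := mul_neg_of_neg_of_pos hneg (hab u hu0.le hux)
      refine lt_of_eq_of_lt ?_ this
      ring
  exact ⟨key _ _ fun u hu hux => (hP.cross_pos hu hux).1,
    key _ _ fun u hu hux => (hP.cross_pos hu hux).2⟩

lemma dPhi_lt {u u' x : ℝ} (hu : d.ubar ≤ u) (huu : u < u') (hu' : u' ≤ d.zlow) (hx : u' ≤ x) :
    d.dPhi u' x < d.dPhi u x :=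
  (hP.Phi_strictAntiOn x).2 ⟨hu, le_min (huu.le.trans hx)
    (huu.le.trans hu')⟩ ⟨hu.trans huu.le, le_min hx hu'⟩ huu

lemma Phi_lt {u u' x : ℝ} (hu : d.ubar ≤ u) (huu : u < u') (hu' : u' ≤ d.zlow) (hx : u' ≤ x) :
    d.Phi u' x < d.Phi u x :=
  (hP.Phi_strictAntiOn x).1 ⟨hu, le_min (huu.le.trans hx)
    (huu.le.trans hu')⟩ ⟨hu.trans huu.le, le_min hx hu'⟩ huu

/-- The slopes of two normalized solutions stay a positive distance apart. -/
lemma exists_dPhi_add_le {u u' : ℝ} (hu : d.ubar ≤ u) (huu : u < u') (hu' : u' ≤ d.zlow) :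
    ∃ δ > 0, ∀ x, d.xlam ≤ x → d.dPhi u' x + δ ≤ d.dPhi u x := by
  have hs := (hP.solPhi u).comb (hP.solPhi u') 1 (-1)
  have hz := hP.zlow_mem.1.2.le
  obtain ⟨δ, hδ, h⟩ := hs.exists_slope_bound hP.coeff fun x hx =>
    ⟨by linarith [hP.Phi_lt hu huu hu' (hu'.trans (hz.trans hx))],
      by linarith [hP.dPhi_lt hu huu hu' (hu'.trans (hz.trans hx))]⟩
  exact ⟨δ, hδ, fun x hx => by linarith [h x hx]⟩

lemma Phi_cont_left (x : ℝ) : ContinuousOn (fun u => d.Phi u x) (Ici 0) := by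
  have hA := hP.coeff.intFactor_cont.continuousOn (s := Ici 0)
  exact (((hA.mul hP.sol1.tangentGap_cont).div_const _).mul_const _).add
    (((hA.mul hP.sol2.tangentGap_cont).div_const _).neg.mul_const _)

lemma dPhi_cont_left (x : ℝ) : ContinuousOn (fun u => d.dPhi u x) (Ici 0) := by
  have hA := hP.coeff.intFactor_cont.continuousOn (s := Ici 0)
  exact (((hA.mul hP.sol1.tangentGap_cont).div_const _).mul_const _).add
    (((hA.mul hP.sol2.tangentGap_cont).div_const _).neg.mul_const _)

lemma Phi_comp_cont {s : Set ℝ} {q : ℝ → ℝ} (hs : s ⊆ Ici 0) (hq : ContinuousOn q s)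
    (hq0 : ∀ u ∈ s, 0 ≤ q u) : ContinuousOn (fun u => d.Phi u (q u)) s := by
  have hA := hP.coeff.intFactor_cont.continuousOn (s := s)
  exact (((hA.mul (hP.sol1.tangentGap_cont.mono hs)).div_const _).mul
      (hP.sol2.cont.comp hq hq0)).add
    (((hA.mul (hP.sol2.tangentGap_cont.mono hs)).div_const _).neg.mul (hP.sol1.cont.comp hq hq0))

lemma betaOf_cont : ContinuousOn d.betaOf (Icc d.ubar d.zlow) :=
  (hP.sol2.tangentGap_cont.mono fun _ ht => hP.ubar_pos.le.trans ht.1).div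
    (hP.sol1.tangentGap_cont.mono fun _ ht => hP.ubar_pos.le.trans ht.1)
    fun _ ht => (hP.gap1_pos ht.1 (ht.2.trans hP.zlow_mem.1.2.le)).ne'

lemma betaOf_strictAntiOn : StrictAntiOn d.betaOf (Icc d.ubar d.zlow) := by
  refine strictAntiOn_of_deriv_neg (convex_Icc _ _) hP.betaOf_cont fun u hu => ?_
  rw [interior_Icc] at hu
  have hu0 := hP.ubar_pos.trans hu.1
  have hg := hP.gap1_pos hu.1.le (hu.2.le.trans hP.zlow_mem.1.2.le)
  have hA := d.intFactor_pos u
  have hd := (hP.sol2.tangentGap_hasDerivAt hP.coeff hu0).div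
    (hP.sol1.tangentGap_hasDerivAt hP.coeff hu0) (mul_pos hA hg).ne'
  have heq : d.betaOf =
      ((fun u => d.intFactor u * d.tangentGap d.g2 (halfLineDeriv d.g2) u) /
        (fun u => d.intFactor u * d.tangentGap d.g1 (halfLineDeriv d.g1) u)) := by
    funext t
    exact (mul_div_mul_left _ _ (d.intFactor_pos t).ne').symm
  rw [heq, hd.deriv]
  refine div_neg_of_neg_of_pos ?_ (by positivity)
  have hw := hP.wronskian hu0.le
  have hm := hP.m_neg hu0.le hu.2
  have hs := mul_pos (hP.coeff.half_sq_pos hu0.le) hP.coeff.k_pos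
  have hy : 0 < u - d.K / d.k := by linarith [hP.K_lt, hu.1]
  have hneg : d.intFactor u * d.m u / (d.sigma u ^ 2 / 2 * d.k) < 0 :=
    div_neg_of_neg_of_pos (mul_neg_of_pos_of_neg hA hm) hs
  refine lt_of_eq_of_lt ?_ (mul_neg_of_neg_of_pos hneg (mul_pos hy hP.wron_pos))
  rw [← hw]
  unfold tangentGap
  ring

lemma betaOf_ubar : d.betaOf d.ubar = 1 := by
  have h := hP.g_ubar
  have hg := hP.gap1_pos le_rfl (hP.ubar_lt_zlow.le.trans hP.zlow_mem.1.2.le)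
  rw [betaOf, div_eq_one_iff_eq hg.ne']
  simp only [tangentGap, g, gb] at h ⊢
  linarith

lemma betaOf_zlow : d.betaOf d.zlow = d.h d.zlow := by
  have h := hP.zlow_mem.2
  rw [hP.m_eq] at h
  have h1 := (mul_eq_zero.1 h).resolve_left hP.coeff.k_pos.ne'
  have hc : ∀ f p : ℝ → ℝ,
      d.curv f p d.zlow = d.intFactor d.zlow * d.lam * d.tangentGap f p d.zlow := by
    intro f p
    unfold curv tangentGap
    linear_combination -(d.intFactor d.zlow * p d.zlow) * h1
  rw [hP.h_eq hP.zlow_pos.le, hc, hc, betaOf,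
    mul_div_mul_left _ _ (mul_pos (d.intFactor_pos _) hP.coeff.lam_pos).ne']

lemma betaOf_mem {u : ℝ} (hu : u ∈ Icc d.ubar d.zlow) : d.betaOf u ∈ Icc (d.h d.zlow) 1 := by
  rw [← hP.betaOf_zlow, ← hP.betaOf_ubar]
  exact ⟨hP.betaOf_strictAntiOn.antitoneOn hu ⟨hP.ubar_lt_zlow.le, le_rfl⟩ hu.2,
    hP.betaOf_strictAntiOn.antitoneOn ⟨le_rfl, hP.ubar_lt_zlow.le⟩ hu hu.1⟩

lemma Phi_eq {u : ℝ} (hu : u ∈ Icc d.ubar d.zlow) (x : ℝ) : d.Phi u x =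
    d.intFactor u * d.tangentGap d.g1 (halfLineDeriv d.g1) u / d.wron * d.gb (d.betaOf u) x := by
  have hg := (hP.gap1_pos hu.1 (hu.2.trans hP.zlow_mem.1.2.le)).ne'
  unfold Phi gb betaOf
  field_simp
  ring

lemma dPhi_eq {u : ℝ} (hu : u ∈ Icc d.ubar d.zlow) {x : ℝ} (hx : 0 ≤ x) : d.dPhi u x =
    d.intFactor u * d.tangentGap d.g1 (halfLineDeriv d.g1) u / d.wron *
      d.dgb (d.betaOf u) x := by
  have hg := (hP.gap1_pos hu.1 (hu.2.trans hP.zlow_mem.1.2.le)).ne'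
  rw [hP.dgb_eq _ hx]
  unfold dPhi betaOf
  field_simp
  ring

lemma dgb_betaOf_pos {u : ℝ} (hu : u ∈ Icc d.ubar d.zlow) : 0 < d.dgb (d.betaOf u) u := by
  have h := hP.dPhi_eq hu (hP.ubar_pos.le.trans hu.1)
  rw [hP.dPhi_self (hP.ubar_pos.le.trans hu.1)] at h
  exact (pos_iff_pos_of_mul_pos (h ▸ one_pos)).1 (hP.Phi_coeff_pos hu)

lemma dgb_div {u : ℝ} (hu : u ∈ Icc d.ubar d.zlow) {x : ℝ} (hx : 0 ≤ x) :
    d.dgb (d.betaOf u) x / d.dgb (d.betaOf u) u = d.dPhi u x := by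
  have h := hP.dPhi_eq hu (hP.ubar_pos.le.trans hu.1)
  rw [hP.dPhi_self (hP.ubar_pos.le.trans hu.1)] at h
  rw [hP.dPhi_eq hu hx, div_eq_iff (hP.dgb_betaOf_pos hu).ne']
  linear_combination d.dgb (d.betaOf u) x * h

lemma gb_div {u : ℝ} (hu : u ∈ Icc d.ubar d.zlow) (x : ℝ) :
    d.gb (d.betaOf u) x / d.dgb (d.betaOf u) u = d.Phi u x := by
  have h := hP.dPhi_eq hu (hP.ubar_pos.le.trans hu.1)
  rw [hP.dPhi_self (hP.ubar_pos.le.trans hu.1)] at h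
  rw [hP.Phi_eq hu x, div_eq_iff (hP.dgb_betaOf_pos hu).ne']
  linear_combination d.gb (d.betaOf u) x * h

lemma curv_Phi {u : ℝ} (hu : u ∈ Icc d.ubar d.zlow) {x : ℝ} (hx : d.x1 ≤ x) :
    d.curv (d.Phi u) (d.dPhi u) x =
      d.intFactor u * d.tangentGap d.g1 (halfLineDeriv d.g1) u / d.wron *
        d.curv d.g1 (halfLineDeriv d.g1) x * (d.h x - d.betaOf u) := by
  have hg := (hP.gap1_pos hu.1 (hu.2.trans hP.zlow_mem.1.2.le)).ne'
  have hc := (hP.curv_g1_pos hx).ne'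
  rw [hP.h_eq (hP.caseR.x1_pos.le.trans hx), betaOf, mul_sub, mul_assoc,
    mul_div_cancel₀ _ hc]
  have h := d.curv_comb d.g2 (halfLineDeriv d.g2) d.g1 (halfLineDeriv d.g1)
    (d.intFactor u * d.tangentGap d.g1 (halfLineDeriv d.g1) u / d.wron)
    (-(d.intFactor u * d.tangentGap d.g2 (halfLineDeriv d.g2) u / d.wron)) x
  refine (h.trans ?_ : d.curv (fun x => _) (fun x => _) x = _)
  field_simp
  ring

/-- A zero of `γ(β, ·)` is a zero of the numerator; where `g'(·; β)` vanishes, the value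
`K - k x` given to `γ` is negative. -/
lemma eq_betaOf_of_gamma_eq_zero {β x : ℝ} (hx : x ∈ Icc d.ubar d.zlow)
    (h : d.gamma β x = 0) : d.betaOf x = β := by
  have hk := hP.coeff.k_pos
  have h0 := hP.ubar_pos.le.trans hx.1
  have hy : 0 < x - d.K / d.k := by linarith [hP.K_lt, hx.1]
  have hKy : d.K = d.k * (d.K / d.k) := (mul_div_cancel₀ _ hk.ne').symm
  have hd : d.dgb β x ≠ 0 := by
    intro h2
    rw [gamma, h2, div_zero] at h
    nlinarith
  have h3 : d.gb β x = (x - d.K / d.k) * d.dgb β x := by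
    rw [← div_eq_iff hd]
    apply mul_left_cancel₀ hk.ne'
    unfold gamma at h
    linear_combination h - hKy
  rw [hP.dgb_eq β h0, gb] at h3
  rw [betaOf, div_eq_iff (hP.gap1_pos hx.1 (hx.2.trans hP.zlow_mem.1.2.le)).ne']
  unfold tangentGap
  linarith

lemma gamma_betaOf {u : ℝ} (hu : u ∈ Icc d.ubar d.zlow) : d.gamma (d.betaOf u) u = 0 := by
  rw [gamma, hP.gb_div hu, hP.Phi_self (hP.ubar_pos.le.trans hu.1)]
  have := hP.coeff.k_pos.ne'
  field_simp
  ring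

lemma u1_spec {β : ℝ} (hβ : β ∈ Icc (d.h d.zlow) 1) :
    d.u1 β ∈ Icc d.ubar d.zlow ∧ d.betaOf (d.u1 β) = β ∧ d.gamma β (d.u1 β) = 0 := by
  have : ∃ u ∈ Icc d.ubar d.zlow, d.gamma β u = 0 := by
    rw [← hP.betaOf_zlow, ← hP.betaOf_ubar] at hβ
    obtain ⟨u, hu, rfl⟩ := intermediate_value_Icc' hP.ubar_lt_zlow.le hP.betaOf_cont hβ
    exact ⟨u, hu, hP.gamma_betaOf hu⟩
  have h1 := Function.invFunOn_mem this
  have h2 := Function.invFunOn_eq this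
  exact ⟨h1, hP.eq_betaOf_of_gamma_eq_zero h1 h2, h2⟩

lemma u1_betaOf {u : ℝ} (hu : u ∈ Icc d.ubar d.zlow) : d.u1 (d.betaOf u) = u := by
  have h := hP.u1_spec (hP.betaOf_mem hu)
  exact hP.betaOf_strictAntiOn.injOn h.1 hu h.2.1

lemma u1_lt_u1 {β β' : ℝ} (hβ : β ∈ Icc (d.h d.zlow) 1) (hβ' : β' ∈ Icc (d.h d.zlow) 1)
    (h : β < β') : d.u1 β' < d.u1 β := by
  have h1 := hP.u1_spec hβ
  have h2 := hP.u1_spec hβ'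
  rw [← h1.2.1, ← h2.2.1] at h
  exact (hP.betaOf_strictAntiOn.lt_iff_gt h1.1 h2.1).1 h

/-- The equation `h(x) = β` is solvable on `[xlam, ∞)` for every `β` in question, because
`h ≥ 1` beyond `x2`. -/
lemma hPlusInv_spec {β : ℝ} (hβ : β ∈ Icc (d.h d.zlow) 1) :
    d.xlam < d.hPlusInv β ∧ d.h (d.hPlusInv β) = β := by
  have hlt : d.h d.xlam < d.h d.zlow := hP.h_strictAntiOn
    ⟨hP.zlow_mem.1.1.le, hP.zlow_mem.1.2.le⟩ ⟨hP.x1_lt_xlam.le, le_rfl⟩ hP.zlow_mem.1.2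
  have hx := hP.caseR.xlam_le_x2
  have : ∃ x ∈ Ici d.xlam, d.h x = β := by
    obtain ⟨x, hx, hx'⟩ := intermediate_value_Icc (show d.xlam ≤ d.x2 + 1 by linarith)
      (hP.h_cont.mono fun x hx => hP.x1_lt_xlam.le.trans hx.1)
      ⟨hlt.le.trans hβ.1, hβ.2.trans (hP.one_le_h (by linarith))⟩
    exact ⟨x, hx.1, hx'⟩
  have h1 : d.hPlusInv β ∈ Ici d.xlam := Function.invFunOn_mem this
  have h2 : d.h (d.hPlusInv β) = β := Function.invFunOn_eq this
  refine ⟨lt_of_le_of_ne h1 fun heq => ?_, h2⟩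
  rw [← heq] at h2
  linarith [hβ.1]

lemma hMinusInv_spec {β : ℝ} (hβ : β ∈ Ioc (d.h d.zlow) 1) :
    d.hMinusInv β ∈ Icc d.x1 d.xlam ∧ d.h (d.hMinusInv β) = β ∧ d.hMinusInv β < d.zlow := by
  have hz := hP.zlow_mem.1
  have : ∃ x ∈ Icc d.x1 d.xlam, d.h x = β := by
    obtain ⟨x, hx, hx'⟩ := intermediate_value_Icc' hz.1.le
      (hP.h_cont.mono fun x hx => hx.1) ⟨hβ.1.le, hβ.2.trans hP.h_x1.ge⟩
    exact ⟨x, ⟨hx.1, hx.2.trans hz.2.le⟩, hx'⟩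
  have h1 : d.hMinusInv β ∈ Icc d.x1 d.xlam := Function.invFunOn_mem this
  have h2 : d.h (d.hMinusInv β) = β := Function.invFunOn_eq this
  refine ⟨h1, h2, ?_⟩
  have h3 := hβ.1
  rw [← h2] at h3
  exact (hP.h_strictAntiOn.lt_iff_gt ⟨hz.1.le, hz.2.le⟩ h1).1 h3

end Problem1

/-! ### Where the slope of a normalized solution equals one -/

/-- The slope of `Phi u` passes through the value `1` exactly at `a` and at `b` after `u`: it is
larger on `(u, a)`, smaller on `(a, b)` and larger on `(b, ∞)`. For `β = betaOf u` these are the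
points `u2 β` and `u3 β`. -/
structure Crossings (d : DividendModel) (u a b : ℝ) : Prop where
  zlow_lt : d.zlow < a
  lt : a < b
  left_eq : d.dPhi u a = 1
  right_eq : d.dPhi u b = 1
  above : ∀ x, u < x → x < a → 1 < d.dPhi u x
  below : ∀ x, a < x → x < b → d.dPhi u x < 1
  above' : ∀ x, b < x → 1 < d.dPhi u x

/-- The integral of `1 - dPhi u` from `u` to `x`. -/
def excess (d : DividendModel) (u x : ℝ) : ℝ := x - d.K / d.k - d.Phi u x

namespace Problem1
variable (hP : d.Problem1)
include hP

lemma betaOf_mem_Ioc {u : ℝ} (hu : u ∈ Ico d.ubar d.zlow) :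
    d.betaOf u ∈ Ioc (d.h d.zlow) 1 := by
  refine ⟨?_, (hP.betaOf_mem ⟨hu.1, hu.2.le⟩).2⟩
  rw [← hP.betaOf_zlow]
  exact hP.betaOf_strictAntiOn ⟨hu.1, hu.2.le⟩ ⟨hP.ubar_lt_zlow.le, le_rfl⟩ hu.2

lemma curv_Phi_strictAntiOn {u : ℝ} (hu : d.ubar ≤ u) :
    StrictAntiOn (d.curv (d.Phi u) (d.dPhi u)) (Icc u d.xlam) :=
  (hP.solPhi u).curv_strictAntiOn hP.coeff (hP.ubar_pos.le.trans hu) le_rfl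
    fun _ hx => (hP.Phi_pos hu hx.1.le).2

lemma curv_Phi_monotoneOn {u : ℝ} (hu : u ∈ Icc d.ubar d.zlow) :
    MonotoneOn (d.curv (d.Phi u) (d.dPhi u)) (Ici d.xlam) :=
  (hP.solPhi u).curv_monotoneOn hP.coeff fun _ hx =>
    (hP.Phi_pos hu.1 ((hu.2.trans hP.zlow_mem.1.2.le).trans hx.le)).2

/-- The point `u1 β` lies where `Phi u` is still convex: by `L f = 0` its weighted second
derivative at `u` is `-m(u)` up to a positive factor. -/
lemma lt_hMinusInv {u : ℝ} (hu : u ∈ Ico d.ubar d.zlow) : u < d.hMinusInv (d.betaOf u) := by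
  have hs := hP.hMinusInv_spec (hP.betaOf_mem_Ioc hu)
  have h0 := hP.ubar_pos.le.trans hu.1
  by_contra! hcon
  have h1 : d.h u ≤ d.betaOf u := by
    have := hP.h_strictAntiOn.antitoneOn hs.1
      ⟨hs.1.1.trans hcon, hu.2.le.trans hP.zlow_mem.1.2.le⟩ hcon
    rwa [hs.2.1] at this
  have h2 := hP.curv_Phi ⟨hu.1, hu.2.le⟩ (hs.1.1.trans hcon)
  rw [curv, hP.Phi_self h0, hP.dPhi_self h0] at h2
  have hm := hP.m_neg h0 hu.2
  rw [hP.m_eq] at hm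
  have h3 : d.mu u - d.lam * (u - d.K / d.k) < 0 :=
    (pos_iff_neg_of_mul_neg hm).1 hP.coeff.k_pos
  have h4 := mul_nonpos_of_nonneg_of_nonpos (mul_pos (hP.Phi_coeff_pos ⟨hu.1, hu.2.le⟩)
    (hP.curv_g1_pos (hs.1.1.trans hcon))).le (sub_nonpos.2 h1)
  rw [← h2] at h4
  have := mul_pos (d.intFactor_pos u) (show
    0 < d.lam * (u - d.K / d.k) - d.mu u * 1 by linarith)
  linarith

lemma curv_Phi_hMinusInv {u : ℝ} (hu : u ∈ Ico d.ubar d.zlow) :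
    d.curv (d.Phi u) (d.dPhi u) (d.hMinusInv (d.betaOf u)) = 0 := by
  have hs := hP.hMinusInv_spec (hP.betaOf_mem_Ioc hu)
  rw [hP.curv_Phi ⟨hu.1, hu.2.le⟩ hs.1.1, hs.2.1, sub_self, mul_zero]

lemma curv_Phi_hPlusInv {u : ℝ} (hu : u ∈ Icc d.ubar d.zlow) :
    d.curv (d.Phi u) (d.dPhi u) (d.hPlusInv (d.betaOf u)) = 0 := by
  have hs := hP.hPlusInv_spec (hP.betaOf_mem hu)
  rw [hP.curv_Phi hu (hP.x1_lt_xlam.le.trans hs.1.le), hs.2, sub_self, mul_zero]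

lemma dPhi_strictMonoOn {u : ℝ} (hu : u ∈ Ico d.ubar d.zlow) :
    StrictMonoOn (d.dPhi u) (Icc u (d.hMinusInv (d.betaOf u))) := by
  have h0 := hP.ubar_pos.le.trans hu.1
  have hs := hP.hMinusInv_spec (hP.betaOf_mem_Ioc hu)
  refine (hP.solPhi u).strictMonoOn_of_curv_pos hP.coeff (convex_Icc _ _)
    (fun x hx => h0.trans hx.1) fun x hx _ => ?_
  rw [interior_Icc] at hx
  rw [← hP.curv_Phi_hMinusInv hu]
  exact hP.curv_Phi_strictAntiOn hu.1 ⟨hx.1.le, hx.2.le.trans hs.1.2⟩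
    ⟨(hx.1.trans hx.2).le, hs.1.2⟩ hx.2

lemma curv_Phi_neg {u : ℝ} (hu : u ∈ Ico d.ubar d.zlow) {x : ℝ}
    (hx : d.hMinusInv (d.betaOf u) < x) (hxl : x ≤ d.xlam) :
    d.curv (d.Phi u) (d.dPhi u) x < 0 := by
  have h := hP.lt_hMinusInv hu
  rw [← hP.curv_Phi_hMinusInv hu]
  exact hP.curv_Phi_strictAntiOn hu.1 ⟨h.le, hx.le.trans hxl⟩ ⟨(h.trans hx).le, hxl⟩ hx

lemma dPhi_antitoneOn {u : ℝ} (hu : u ∈ Ico d.ubar d.zlow) : AntitoneOn (d.dPhi u)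
    (Icc (d.hMinusInv (d.betaOf u)) (d.hPlusInv (d.betaOf u))) := by
  have h0 := hP.ubar_pos.le.trans hu.1
  have h := hP.lt_hMinusInv hu
  have hq := hP.hPlusInv_spec (hP.betaOf_mem ⟨hu.1, hu.2.le⟩)
  refine (hP.solPhi u).antitoneOn_of_curv_nonpos hP.coeff (convex_Icc _ _)
    (fun x hx => h0.trans (h.le.trans hx.1)) fun x hx _ => ?_
  rw [interior_Icc] at hx
  rcases le_total x d.xlam with hxl | hxl
  · exact (hP.curv_Phi_neg hu hx.1 hxl).le
  · rw [← hP.curv_Phi_hPlusInv ⟨hu.1, hu.2.le⟩]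
    exact hP.curv_Phi_monotoneOn ⟨hu.1, hu.2.le⟩ hxl hq.1.le hx.2.le

lemma dPhi_monotoneOn {u : ℝ} (hu : u ∈ Icc d.ubar d.zlow) :
    MonotoneOn (d.dPhi u) (Ici (d.hPlusInv (d.betaOf u))) := by
  have hq := hP.hPlusInv_spec (hP.betaOf_mem hu)
  refine (hP.solPhi u).monotoneOn_of_curv_nonneg hP.coeff (convex_Ici _)
    (fun x hx => hP.xlam_pos.le.trans (hq.1.le.trans hx)) fun x hx _ => ?_
  rw [interior_Ici] at hx
  rw [← hP.curv_Phi_hPlusInv hu]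
  exact hP.curv_Phi_monotoneOn hu hq.1.le (hq.1.trans hx).le (le_of_lt hx)

lemma one_lt_dPhi_hMinusInv {u : ℝ} (hu : u ∈ Ico d.ubar d.zlow) :
    1 < d.dPhi u (d.hMinusInv (d.betaOf u)) := by
  have h := hP.lt_hMinusInv hu
  have := hP.dPhi_strictMonoOn hu (left_mem_Icc.2 h.le) (right_mem_Icc.2 h.le) h
  rwa [hP.dPhi_self (hP.ubar_pos.le.trans hu.1)] at this

lemma hMinusInv_lt_hPlusInv {u : ℝ} (hu : u ∈ Ico d.ubar d.zlow) :
    d.hMinusInv (d.betaOf u) < d.hPlusInv (d.betaOf u) :=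
  (hP.hMinusInv_spec (hP.betaOf_mem_Ioc hu)).1.2.trans_lt
    (hP.hPlusInv_spec (hP.betaOf_mem ⟨hu.1, hu.2.le⟩)).1

/-- Where the slope of `Phi u` is below `1`, it is no smaller than at `h₊⁻¹(β)`. -/
lemma dPhi_hPlusInv_le {u : ℝ} (hu : u ∈ Ico d.ubar d.zlow) {x : ℝ} (hx : u ≤ x)
    (hlt : d.dPhi u x < 1) : d.dPhi u (d.hPlusInv (d.betaOf u)) ≤ d.dPhi u x := by
  have h := hP.lt_hMinusInv hu
  have hpq := hP.hMinusInv_lt_hPlusInv hu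
  rcases le_total x (d.hMinusInv (d.betaOf u)) with hxp | hxp
  · have := (hP.dPhi_strictMonoOn hu).monotoneOn (left_mem_Icc.2 h.le) ⟨hx, hxp⟩ hx
    rw [hP.dPhi_self (hP.ubar_pos.le.trans hu.1)] at this
    exact absurd hlt (not_lt.2 this)
  rcases le_total x (d.hPlusInv (d.betaOf u)) with hxq | hxq
  · exact hP.dPhi_antitoneOn hu ⟨hxp, hxq⟩ (right_mem_Icc.2 hpq.le) hxq
  · exact hP.dPhi_monotoneOn ⟨hu.1, hu.2.le⟩ self_mem_Ici hxq hxq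

lemma curv_eq_zero_of_const {u y y' : ℝ} (hy : 0 ≤ y) {c : ℝ}
    (h : ∀ x ∈ Ioo y y', d.dPhi u x = c) {x : ℝ} (hx : x ∈ Ioo y y') :
    d.curv (d.Phi u) (d.dPhi u) x = 0 := by
  have hx0 := hy.trans_lt hx.1
  have h1 := (hP.solPhi u).deriv_hasDerivAt_curv hx0
  have h2 : d.dPhi u =ᶠ[𝓝 x] fun _ => c := by
    filter_upwards [Ioo_mem_nhds hx.1 hx.2] with t ht using h t ht
  have h3 := h1.unique ((hasDerivAt_const x c).congr_of_eventuallyEq h2)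
  rw [div_eq_zero_iff] at h3
  exact h3.resolve_right (Sol.weight_pos hP.coeff hx0.le).ne'

lemma zlow_lt_of_dPhi_le_one {u : ℝ} (hu : u ∈ Ico d.ubar d.zlow) {a : ℝ}
    (ha : d.hMinusInv (d.betaOf u) < a) (ha1 : d.dPhi u a ≤ 1) : d.zlow < a := by
  by_contra! hcon
  have hz := hP.dPhi_lt hu.1 hu.2 le_rfl le_rfl
  rw [hP.dPhi_self hP.zlow_pos.le] at hz
  have hq := (hP.hPlusInv_spec (hP.betaOf_mem ⟨hu.1, hu.2.le⟩)).1
  have hzq := hP.zlow_mem.1.2.le.trans hq.le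
  have := hP.dPhi_antitoneOn hu ⟨ha.le, hcon.trans hzq⟩ ⟨ha.le.trans hcon, hzq⟩ hcon
  linarith

/-- The slope of `Phi u` may be constant near `h₊⁻¹(β)` (where `μ' = λ`), but at a value below
`1`, so that it crosses the value `1` strictly. -/
lemma crossings_of_eq_one {u a b : ℝ} (hu : u ∈ Ico d.ubar d.zlow)
    (hq1 : d.dPhi u (d.hPlusInv (d.betaOf u)) < 1)
    (ha : a ∈ Ioo (d.hMinusInv (d.betaOf u)) (d.hPlusInv (d.betaOf u))) (ha1 : d.dPhi u a = 1)
    (hb : d.hPlusInv (d.betaOf u) < b) (hb1 : d.dPhi u b = 1) : d.Crossings u a b := by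
  have hu' : u ∈ Icc d.ubar d.zlow := ⟨hu.1, hu.2.le⟩
  have h0 := hP.ubar_pos.le.trans hu.1
  have h := hP.lt_hMinusInv hu
  have hpq := hP.hMinusInv_lt_hPlusInv hu
  have hq := hP.hPlusInv_spec (hP.betaOf_mem hu')
  have hcq := hP.curv_Phi_hPlusInv hu'
  have hself := hP.dPhi_self h0
  set p := d.hMinusInv (d.betaOf u)
  set q := d.hPlusInv (d.betaOf u)
  have hanti := hP.dPhi_antitoneOn hu
  have hmono := hP.dPhi_monotoneOn hu'
  have hcm := hP.curv_Phi_monotoneOn hu'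
  have hleft : ∀ x y, p ≤ x → x < y → y ≤ q → d.dPhi u q < d.dPhi u x →
      d.dPhi u y < d.dPhi u x := by
    intro x y hpx hxy hyq hlt
    by_contra! hcon
    have hconst : ∀ t ∈ Ioo x y, d.dPhi u t = d.dPhi u x := by
      intro t ht
      have htm : t ∈ Icc p q := ⟨hpx.trans ht.1.le, ht.2.le.trans hyq⟩
      have h1 := hanti ⟨hpx, hxy.le.trans hyq⟩ htm ht.1.le
      have h2 := hanti htm ⟨hpx.trans hxy.le, hyq⟩ ht.2.le
      linarith
    obtain ⟨t, ht⟩ := exists_between hxy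
    have hct := hP.curv_eq_zero_of_const (h0.trans (h.le.trans hpx)) hconst ht
    have htq := ht.2.le.trans hyq
    have htl : d.xlam < t := by
      by_contra! hle
      exact (hP.curv_Phi_neg hu (hpx.trans_lt ht.1) hle).ne hct
    -- the weighted second derivative is nonnegative from `t` to `q`
    have hm : MonotoneOn (d.dPhi u) (Icc t q) := by
      refine (hP.solPhi u).monotoneOn_of_curv_nonneg hP.coeff (convex_Icc _ _)
        (fun y hy => hP.xlam_pos.le.trans (htl.le.trans hy.1)) fun y hy _ => ?_
      rw [interior_Icc] at hy
      rw [← hct]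
      exact hcm htl.le (htl.trans hy.1).le hy.1.le
    have := hm (left_mem_Icc.2 htq) (right_mem_Icc.2 htq) htq
    rw [hconst t ht] at this
    linarith
  have hstep : ∀ x y, q ≤ x → x < y → d.dPhi u q < d.dPhi u y → d.dPhi u x < d.dPhi u y := by
    intro x y hqx hxy hlt
    by_contra! hcon
    have hconst : ∀ t ∈ Ioo x y, d.dPhi u t = d.dPhi u y := by
      intro t ht
      have h1 := hmono hqx (hqx.trans ht.1.le) ht.1.le
      have h2 := hmono (hqx.trans ht.1.le) (hqx.trans hxy.le) ht.2.le
      linarith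
    obtain ⟨t, ht⟩ := exists_between hxy
    have hct := hP.curv_eq_zero_of_const (hP.xlam_pos.le.trans (hq.1.le.trans hqx)) hconst ht
    have hqt := hqx.trans ht.1.le
    have hm : AntitoneOn (d.dPhi u) (Icc q t) := by
      refine (hP.solPhi u).antitoneOn_of_curv_nonpos hP.coeff (convex_Icc _ _)
        (fun y hy => hP.xlam_pos.le.trans (hq.1.le.trans hy.1)) fun y hy _ => ?_
      rw [interior_Icc] at hy
      rw [← hct]
      exact hcm (hq.1.trans hy.1).le (hq.1.le.trans hqt) hy.2.le
    have := hm (left_mem_Icc.2 hqt) (right_mem_Icc.2 hqt) hqt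
    rw [hconst t ht] at this
    linarith
  refine ⟨hP.zlow_lt_of_dPhi_le_one hu ha.1 ha1.le, ha.2.trans hb, ha1, hb1, ?_, ?_, ?_⟩
  · intro x hux hxa
    rcases le_total x p with hxp | hxp
    · have := hP.dPhi_strictMonoOn hu (left_mem_Icc.2 h.le) ⟨hux.le, hxp⟩ hux
      rwa [hself] at this
    · by_contra! hcon
      have hge := hanti ⟨hxp, hxa.le.trans ha.2.le⟩ ⟨ha.1.le, ha.2.le⟩ hxa.le
      have := hleft x a hxp hxa ha.2.le (by linarith)
      linarith
  · intro x hax hxb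
    rcases le_total x q with hxq | hxq
    · rw [← ha1]
      exact hleft a x ha.1.le hax hxq (by rw [ha1]; exact hq1)
    · rw [← hb1]
      exact hstep x b hxq hxb (by rw [hb1]; exact hq1)
  · intro x hbx
    have hle := hmono hb.le (hb.trans hbx).le hbx.le
    rw [← hb1]
    exact hstep b x hb.le hbx (by linarith)

lemma exists_eq_one {u X : ℝ} (hu : u ∈ Ico d.ubar d.zlow)
    (hq1 : d.dPhi u (d.hPlusInv (d.betaOf u)) < 1) (hX : d.hPlusInv (d.betaOf u) ≤ X)
    (hX1 : 1 < d.dPhi u X) :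
    (∃ a ∈ Ioo (d.hMinusInv (d.betaOf u)) (d.hPlusInv (d.betaOf u)), d.dPhi u a = 1) ∧
      ∃ b ∈ Ioi (d.hPlusInv (d.betaOf u)), d.dPhi u b = 1 := by
  have h0 := hP.ubar_pos.le.trans hu.1
  have h := hP.lt_hMinusInv hu
  have hpq := hP.hMinusInv_lt_hPlusInv hu
  constructor
  · exact intermediate_value_Ioo' hpq.le ((hP.solPhi u).contDeriv.mono fun x hx =>
      h0.trans (h.le.trans hx.1)) ⟨hq1, hP.one_lt_dPhi_hMinusInv hu⟩
  · obtain ⟨b, hb, hb1⟩ := intermediate_value_Ioo hX ((hP.solPhi u).contDeriv.mono fun x hx =>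
      h0.trans ((h.trans hpq).le.trans hx.1)) ⟨hq1, hX1⟩
    exact ⟨b, hb.1, hb1⟩

lemma excess_hasDerivAt (u : ℝ) {x : ℝ} (hx : 0 < x) :
    HasDerivAt (d.excess u) (1 - d.dPhi u x) x :=
  ((hasDerivAt_id x).sub_const _).sub ((hP.solPhi u).hasDeriv x hx)

lemma excess_cont (u : ℝ) : ContinuousOn (d.excess u) (Ici 0) :=
  (continuousOn_id.sub continuousOn_const).sub (hP.solPhi u).cont

lemma excess_self {u : ℝ} (hu : 0 ≤ u) : d.excess u u = 0 := by
  rw [excess, hP.Phi_self hu, sub_self]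

lemma excess_strictAntiOn {u : ℝ} {s : Set ℝ} (hs : Convex ℝ s) (hs0 : s ⊆ Ici 0)
    (h : ∀ x ∈ interior s, 1 < d.dPhi u x) : StrictAntiOn (d.excess u) s := by
  refine strictAntiOn_of_deriv_neg hs ((hP.excess_cont u).mono hs0) fun x hx => ?_
  have hx0 : 0 < x := by simpa [interior_Ici] using interior_mono hs0 hx
  rw [(hP.excess_hasDerivAt u hx0).deriv]
  linarith [h x hx]

lemma excess_strictMonoOn {u : ℝ} {s : Set ℝ} (hs : Convex ℝ s) (hs0 : s ⊆ Ici 0)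
    (h : ∀ x ∈ interior s, d.dPhi u x < 1) : StrictMonoOn (d.excess u) s := by
  refine strictMonoOn_of_deriv_pos hs ((hP.excess_cont u).mono hs0) fun x hx => ?_
  have hx0 : 0 < x := by simpa [interior_Ici] using interior_mono hs0 hx
  rw [(hP.excess_hasDerivAt u hx0).deriv]
  linarith [h x hx]

end Problem1

namespace Crossings
variable {u a b u' a' b' : ℝ}

lemma mem_Ioo_of_lt (h : d.Crossings u a b) {x : ℝ} (hux : u < x) (hx : d.dPhi u x < 1) :
    x ∈ Ioo a b := by
  constructor
  · by_contra! hcon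
    rcases hcon.eq_or_lt with rfl | hlt
    · exact hx.ne h.left_eq
    · exact absurd (h.above x hux hlt) (not_lt.2 hx.le)
  · by_contra! hcon
    rcases hcon.eq_or_lt with rfl | hlt
    · exact hx.ne h.right_eq
    · exact absurd (h.above' x hlt) (not_lt.2 hx.le)

lemma notMem_Icc_of_gt (h : d.Crossings u a b) {x : ℝ} (hx : 1 < d.dPhi u x) :
    x < a ∨ b < x := by
  by_contra! hcon
  rcases hcon.1.eq_or_lt with rfl | h1
  · exact hx.ne' h.left_eq
  rcases hcon.2.eq_or_lt with rfl | h2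
  · exact hx.ne' h.right_eq
  · exact absurd (h.below x h1 h2) (not_lt.2 hx.le)

lemma mem_Ioo_right (hP : d.Problem1) (h : d.Crossings u a b) (h' : d.Crossings u' a' b')
    (hu : d.ubar ≤ u) (huu : u < u') (hu' : u' ≤ d.zlow) : b ∈ Ioo a' b' :=
  h'.mem_Ioo_of_lt (hu'.trans_lt (h.zlow_lt.trans h.lt))
    (h.right_eq ▸ hP.dPhi_lt hu huu hu' (hu'.trans (h.zlow_lt.trans h.lt).le))

variable (hP : d.Problem1)
include hP

lemma excess_anti (hu : u ∈ Ico d.ubar d.zlow) (h : d.Crossings u a b) :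
    StrictAntiOn (d.excess u) (Icc u a) :=
  hP.excess_strictAntiOn (convex_Icc _ _)
    (fun _ hx => (hP.ubar_pos.le.trans hu.1).trans hx.1) fun x hx => by
      rw [interior_Icc] at hx
      exact h.above x hx.1 hx.2

lemma excess_mono (h : d.Crossings u a b) : StrictMonoOn (d.excess u) (Icc a b) :=
  hP.excess_strictMonoOn (convex_Icc _ _)
    (fun _ hx => (hP.zlow_pos.trans h.zlow_lt).le.trans hx.1) fun x hx => by
      rw [interior_Icc] at hx
      exact h.below x hx.1 hx.2

lemma excess_anti' (h : d.Crossings u a b) : StrictAntiOn (d.excess u) (Ici b) :=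
  hP.excess_strictAntiOn (convex_Ici _)
    (fun _ hx => (hP.zlow_pos.trans (h.zlow_lt.trans h.lt)).le.trans hx) fun x hx => by
      rw [interior_Ici] at hx
      exact h.above' x hx

lemma excess_le_right (h : d.Crossings u a b) {x : ℝ} (hx : a ≤ x) :
    d.excess u x ≤ d.excess u b := by
  rcases le_total x b with hxb | hxb
  · exact (h.excess_mono hP).monotoneOn ⟨hx, hxb⟩ (right_mem_Icc.2 h.lt.le) hxb
  · exact (h.excess_anti' hP).antitoneOn self_mem_Ici hxb hxb

lemma excess_le (hu : u ∈ Ico d.ubar d.zlow) (h : d.Crossings u a b) {y x : ℝ}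
    (hy : u ≤ y) (hx : y ≤ x) :
    d.excess u x ≤ max (d.excess u y) (d.excess u b) := by
  rcases le_total x a with hxa | hxa
  · exact le_max_of_le_left
      ((h.excess_anti hP hu).antitoneOn ⟨hy, hx.trans hxa⟩ ⟨hy.trans hx, hxa⟩ hx)
  · exact le_max_of_le_right (h.excess_le_right hP hxa)

/-- The largest increase of the excess is the one from `a` to `b`. -/
lemma excess_sub_le (hu : u ∈ Ico d.ubar d.zlow) (h : d.Crossings u a b) {s t : ℝ}
    (hs : u ≤ s) (hst : s ≤ t) :
    d.excess u t - d.excess u s ≤ d.excess u b - d.excess u a := by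
  have hab : d.excess u a ≤ d.excess u b := h.excess_le_right hP le_rfl
  rcases le_total t a with hta | hta
  · have := (h.excess_anti hP hu).antitoneOn ⟨hs, hst.trans hta⟩ ⟨hs.trans hst, hta⟩ hst
    linarith
  rcases le_total s b with hsb | hsb
  · have h1 := h.excess_le_right hP hta
    have h2 : d.excess u a ≤ d.excess u s := by
      rcases le_total s a with hsa | hsa
      · exact (h.excess_anti hP hu).antitoneOn ⟨hs, hsa⟩ (right_mem_Icc.2 (hs.trans hsa)) hsa
      · exact (h.excess_mono hP).monotoneOn (left_mem_Icc.2 h.lt.le) ⟨hsa, hsb⟩ hsa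
    linarith
  · have := (h.excess_anti' hP).antitoneOn hsb (hsb.trans hst) hst
    linarith

end Crossings

namespace Problem1
variable (hP : d.Problem1)
include hP

/-- The crossing points depend continuously on `u`: their position relative to a given point is
decided by strict inequalities that persist near `u`. -/
lemma crossings_cont {S : Set ℝ} (hS : S ⊆ Ico d.ubar d.zlow) {a b : ℝ → ℝ}
    (hab : ∀ u ∈ S, d.Crossings u (a u) (b u)) : ContinuousOn a S ∧ ContinuousOn b S := by
  have hc : ∀ x, ContinuousOn (fun u => d.dPhi u x) S := fun x =>
    (hP.dPhi_cont_left x).mono fun u hu => hP.ubar_pos.le.trans (hS hu).1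
  -- a point strictly between `a` and `b` stays there
  have hmid : ∀ u ∈ S, ∀ y, a u < y → y < b u → ∀ᶠ t in 𝓝[S] u, a t < y ∧ y < b t := by
    intro u hu y hy hy'
    have h := hab u hu
    filter_upwards [(hc y u hu).eventually_lt_const (h.below y hy hy'), self_mem_nhdsWithin]
      with t ht htS
    exact (hab t htS).mem_Ioo_of_lt ((hS htS).2.trans (h.zlow_lt.trans hy)) ht
  constructor
  · intro u hu
    have h := hab u hu
    obtain ⟨w, hw⟩ := exists_between h.lt
    refine tendsto_order.2 ⟨fun y hy => ?_, fun y hy => ?_⟩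
    · have h1 : max y d.zlow < a u := max_lt hy h.zlow_lt
      have h2 := h.above _ ((hS hu).2.trans_le (le_max_right _ _)) h1
      filter_upwards [hmid u hu w hw.1 hw.2, (hc _ u hu).eventually_const_lt h2,
        self_mem_nhdsWithin] with t ht ht' htS
      rcases (hab t htS).notMem_Icc_of_gt ht' with h3 | h3
      · exact (le_max_left _ _).trans_lt h3
      · exact absurd (h3.trans (h1.trans hw.1)) (not_lt.2 ht.2.le)
    · filter_upwards [hmid u hu (min y w) (lt_min hy hw.1) ((min_le_right _ _).trans_lt hw.2)]
        with t ht
      exact ht.1.trans_le (min_le_left _ _)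
  · intro u hu
    have h := hab u hu
    obtain ⟨w, hw⟩ := exists_between h.lt
    refine tendsto_order.2 ⟨fun y hy => ?_, fun y hy => ?_⟩
    · filter_upwards [hmid u hu (max y w) (hw.1.trans_le (le_max_right _ _)) (max_lt hy hw.2)]
        with t ht
      exact (le_max_left _ _).trans_lt ht.2
    · filter_upwards [hmid u hu w hw.1 hw.2, (hc _ u hu).eventually_const_lt (h.above' y hy),
        self_mem_nhdsWithin] with t ht ht' htS
      rcases (hab t htS).notMem_Icc_of_gt ht' with h3 | h3
      · exact absurd (h3.trans ht.1) (not_lt.2 (hw.2.trans hy).le)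
      · exact h3

end Problem1

/-! ### Optimality of `cstar` -/

lemma _root_.HasDerivAt.nonneg_of_eventually_le_left {f : ℝ → ℝ} {f' x : ℝ}
    (hf : HasDerivAt f f' x) (h : ∀ᶠ t in 𝓝[<] x, f t ≤ f x) : 0 ≤ f' := by
  refine ge_of_tendsto ((hasDerivAt_iff_tendsto_slope.1 hf).mono_left
    (nhdsWithin_mono x fun t (ht : t ∈ Iio x) => ne_of_lt ht)) ?_
  filter_upwards [h, self_mem_nhdsWithin] with t ht htx
  rw [slope_def_field]
  exact div_nonneg_of_nonpos (sub_nonpos.2 ht) (sub_nonpos.2 (le_of_lt htx))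

lemma _root_.HasDerivAt.nonpos_of_eventually_le_right {f : ℝ → ℝ} {f' x : ℝ}
    (hf : HasDerivAt f f' x) (h : ∀ᶠ t in 𝓝[>] x, f t ≤ f x) : f' ≤ 0 := by
  refine le_of_tendsto ((hasDerivAt_iff_tendsto_slope.1 hf).mono_left
    (nhdsWithin_mono x fun t (ht : t ∈ Ioi x) => ne_of_gt ht)) ?_
  filter_upwards [h, self_mem_nhdsWithin] with t ht htx
  rw [slope_def_field]
  exact div_nonpos_of_nonpos_of_nonneg (sub_nonpos.2 ht) (sub_nonneg.2 (le_of_lt htx))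

namespace Problem1
variable (hP : d.Problem1)
include hP

lemma g_strictMonoOn : StrictMonoOn d.g (Ici 0) := by
  refine strictMonoOn_of_deriv_pos (convex_Ici 0) hP.solg.cont fun x hx => ?_
  rw [interior_Ici] at hx
  rw [(hP.solg.hasDeriv x hx).deriv]
  exact (hP.g_pos hx).2

lemma g_hasDerivAt {x : ℝ} (hx : 0 < x) : HasDerivAt d.g (d.dg x) x := by
  rw [hP.dg_eq hx.le]
  exact hP.solg.hasDeriv x hx

lemma dg_pos {x : ℝ} (hx : 0 < x) : 0 < d.dg x := by
  rw [hP.dg_eq hx.le]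
  exact (hP.g_pos hx).2

lemma dg_zero_lt {x : ℝ} (hx : 0 < x) (hx1 : x ≤ d.x1) : d.dg 0 < d.dg x := by
  rw [hP.dg_eq hx.le, hP.dg_eq le_rfl]
  refine hP.solg.strictMonoOn_of_curv_pos hP.coeff (convex_Icc 0 d.x1) (fun t ht => ht.1)
    (fun t ht _ => ?_) ⟨le_rfl, hP.caseR.x1_pos.le⟩ ⟨hx.le, hx1⟩ hx
  rw [interior_Icc] at ht
  exact hP.curv_g_pos ht.1.le ht.2

/-- Optimality of `cstar` over all pairs of barriers `a ≤ b ≤ b₀`, if `b₀` is a point beyond which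
raising the upper barrier does not pay. The ratio `(k (b - a) - K) / (g b - g a)` has a maximum
on the pairs with `b - a ≥ K / k`. If `I(a, b, cstar) > K` for some pair, this maximum is larger
than `cstar`; by the first order conditions it belongs to `C₁ ∪ C₂`. -/
lemma I_le_K {b₀ : ℝ} (hb₀ : 0 < b₀) (hb₀' : d.k ≤ d.cstar * d.dg b₀) {a b : ℝ} (ha : 0 ≤ a)
    (hab : a ≤ b) (hb : b ≤ b₀) : d.I a b d.cstar ≤ d.K := by
  by_contra! hI
  have hk := hP.coeff.k_pos
  have hc := hP.cstar_pos
  have hKk : 0 < d.K / d.k := div_pos hP.coeff.K_pos hk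
  have hKe : d.k * (d.K / d.k) = d.K := mul_div_cancel₀ _ hk.ne'
  set T : Set (ℝ × ℝ) := {q | 0 ≤ q.1 ∧ q.2 ≤ b₀ ∧ q.1 + d.K / d.k ≤ q.2} with hT
  have hTc : IsCompact T := by
    refine (isCompact_Icc (a := ((0, 0) : ℝ × ℝ)) (b := (b₀, b₀))).of_isClosed_subset ?_ ?_
    · exact (isClosed_le continuous_const continuous_fst).inter
        ((isClosed_le continuous_snd continuous_const).inter
          (isClosed_le (continuous_fst.add continuous_const) continuous_snd))
    · rintro ⟨s, t⟩ ⟨h1, h2, h3⟩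
      simp only at h1 h2 h3
      exact ⟨⟨h1, by simp only; linarith⟩, ⟨by simp only; linarith, h2⟩⟩
  have hgpos : ∀ q ∈ T, 0 < d.g q.2 - d.g q.1 := by
    rintro ⟨s, t⟩ ⟨h1, h2, h3⟩
    simp only at h1 h2 h3
    have hst : s < t := by linarith
    exact sub_pos.2 (hP.g_strictMonoOn h1 (h1.trans hst.le) hst)
  have hrc : ContinuousOn (fun q : ℝ × ℝ => (d.k * (q.2 - q.1) - d.K) / (d.g q.2 - d.g q.1)) T := by
    refine ContinuousOn.div (by fun_prop) ?_ fun q hq => (hgpos q hq).ne'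
    exact (hP.solg.cont.comp continuousOn_snd fun q hq => mem_Ici.2
      (by linarith [hq.1, hq.2.2])).sub (hP.solg.cont.comp continuousOn_fst fun q hq => hq.1)
  have hgab : 0 ≤ d.g b - d.g a :=
    sub_nonneg.2 (hP.g_strictMonoOn.monotoneOn ha (ha.trans hab) hab)
  have habT : (a, b) ∈ T := by
    refine ⟨ha, hb, ?_⟩
    unfold I at hI
    have := mul_nonneg hc.le hgab
    simp only
    nlinarith
  obtain ⟨⟨a₁, b₁⟩, hq, hmax⟩ := hTc.exists_isMaxOn ⟨_, habT⟩ hrc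
  set c₁ := (d.k * (b₁ - a₁) - d.K) / (d.g b₁ - d.g a₁) with hc₁
  have hcc : d.cstar < c₁ := by
    have h1 : d.cstar < (d.k * (b - a) - d.K) / (d.g b - d.g a) := by
      rw [lt_div_iff₀ (hgpos _ habT)]
      unfold I at hI
      linarith
    exact h1.trans_le (hmax habT)
  have hc₁pos := hc.trans hcc
  have hIle : ∀ s t, (s, t) ∈ T → d.I s t c₁ ≤ d.K := by
    intro s t hst
    have h1 : (d.k * (t - s) - d.K) / (d.g t - d.g s) ≤ c₁ := hmax hst
    rw [div_le_iff₀ (hgpos _ hst)] at h1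
    unfold I
    linarith
  have hIeq : d.I a₁ b₁ c₁ = d.K := by
    have h1 : c₁ * (d.g b₁ - d.g a₁) = d.k * (b₁ - a₁) - d.K :=
      div_mul_cancel₀ _ (hgpos _ hq).ne'
    unfold I
    linarith
  obtain ⟨ha₁, hb₁, -⟩ := id hq
  simp only at ha₁ hb₁
  have hgap : a₁ + d.K / d.k < b₁ := by
    have h1 := mul_pos hc₁pos (hgpos _ hq)
    unfold I at hIeq
    simp only at h1
    nlinarith
  have hb₁pos : 0 < b₁ := by linarith
  -- first order conditions at the upper barrier
  have hdb : HasDerivAt (fun t => d.I a₁ t c₁) (d.k - c₁ * d.dg b₁) b₁ :=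
    ((((hasDerivAt_id b₁).sub_const a₁).const_mul d.k).sub
      (((hP.g_hasDerivAt hb₁pos).sub_const (d.g a₁)).const_mul c₁)).congr_deriv (by simp)
  have hbl := hdb.nonneg_of_eventually_le_left (by
    filter_upwards [Ioo_mem_nhdsLT hgap] with t ht
    rw [hIeq]
    exact hIle _ _ ⟨ha₁, ht.2.le.trans hb₁, ht.1.le⟩)
  have hb₁lt : b₁ < b₀ := by
    refine lt_of_le_of_ne hb₁ fun heq => ?_
    rw [heq] at hbl
    have := mul_lt_mul_of_pos_right hcc (hP.dg_pos hb₀)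
    linarith
  have hbr := hdb.nonpos_of_eventually_le_right (by
    filter_upwards [Ioo_mem_nhdsGT hb₁lt] with t ht
    rw [hIeq]
    exact hIle _ _ ⟨ha₁, ht.2.le, by simp only; linarith [ht.1]⟩)
  have hbk : c₁ * d.dg b₁ = d.k := by linarith
  suffices hmem : c₁ ∈ d.C1 ∪ d.C2 from absurd (hP.barrierData.cstar_max.2 hmem) (not_le.2 hcc)
  rcases ha₁.eq_or_lt with h0 | h0
  · right
    refine ⟨hc₁pos, b₁, hb₁pos, hbk, ?_, by rw [h0]; exact hIeq⟩
    -- otherwise raising the lower barrier from `0` would pay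
    by_contra! hcon
    set e := min d.x1 (b₁ - d.K / d.k) with he
    have hepos : 0 < e := lt_min hP.caseR.x1_pos (by linarith)
    have hm : StrictMonoOn (fun t => d.I t b₁ c₁) (Icc 0 e) := by
      refine strictMonoOn_of_deriv_pos (convex_Icc 0 e) ?_ fun t ht => ?_
      · unfold I
        exact ContinuousOn.sub (by fun_prop) (continuousOn_const.mul (continuousOn_const.sub
          (hP.solg.cont.mono fun t ht => ht.1)))
      · rw [interior_Icc] at ht
        have hd : HasDerivAt (fun t => d.I t b₁ c₁) (c₁ * d.dg t - d.k) t :=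
          ((((hasDerivAt_id t).const_sub b₁).const_mul d.k).sub
            (((hP.g_hasDerivAt ht.1).const_sub (d.g b₁)).const_mul c₁)).congr_deriv (by ring)
        rw [hd.deriv]
        have h1 := hP.dg_zero_lt ht.1 (ht.2.le.trans (min_le_left _ _))
        have := mul_lt_mul_of_pos_left h1 hc₁pos
        linarith
    have h1 := hm (left_mem_Icc.2 hepos.le) (right_mem_Icc.2 hepos.le) hepos
    simp only at h1
    have h2 := hIle e b₁ ⟨hepos.le, hb₁, by
      simp only; linarith [min_le_right d.x1 (b₁ - d.K / d.k)]⟩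
    rw [← h0] at hIeq
    linarith
  · left
    have hda : HasDerivAt (fun t => d.I t b₁ c₁) (c₁ * d.dg a₁ - d.k) a₁ :=
      ((((hasDerivAt_id a₁).const_sub b₁).const_mul d.k).sub
        (((hP.g_hasDerivAt h0).const_sub (d.g b₁)).const_mul c₁)).congr_deriv (by ring)
    have hal := hda.nonneg_of_eventually_le_left (by
      filter_upwards [Ioo_mem_nhdsLT h0] with t ht
      rw [hIeq]
      exact hIle _ _ ⟨ht.1.le, hb₁, by simp only; linarith [ht.2]⟩)
    have har := hda.nonpos_of_eventually_le_right (by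
      filter_upwards [Ioo_mem_nhdsGT (show a₁ < b₁ - d.K / d.k by linarith)] with t ht
      rw [hIeq]
      exact hIle _ _ ⟨(h0.trans ht.1).le, hb₁, by simp only; linarith [ht.2]⟩)
    exact ⟨hc₁pos, a₁, b₁, h0, by linarith, by linarith, hbk, hIeq⟩

lemma Phi_ubar (x : ℝ) : d.k * d.Phi d.ubar x = d.cstar * d.g x := by
  have h := hP.gb_div ⟨le_rfl, hP.ubar_lt_zlow.le⟩ x
  rw [hP.betaOf_ubar] at h
  have h1 : d.cstar * d.dgb 1 d.ubar = d.k := hP.cstar_mul_dg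
  have h2 : d.dgb 1 d.ubar ≠ 0 := fun h0 => by
    rw [h0, mul_zero] at h1
    exact hP.coeff.k_pos.ne h1
  rw [← h, ← h1, g]
  field_simp

lemma dPhi_ubar {x : ℝ} (hx : 0 ≤ x) : d.k * d.dPhi d.ubar x = d.cstar * d.dg x := by
  have h := hP.dgb_div ⟨le_rfl, hP.ubar_lt_zlow.le⟩ hx
  rw [hP.betaOf_ubar] at h
  have h1 : d.cstar * d.dgb 1 d.ubar = d.k := hP.cstar_mul_dg
  have h2 : d.dgb 1 d.ubar ≠ 0 := fun h0 => by
    rw [h0, mul_zero] at h1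
    exact hP.coeff.k_pos.ne h1
  rw [← h, ← h1, show d.dg x = d.dgb 1 x from rfl]
  field_simp

lemma k_mul_excess_sub (s t : ℝ) :
    d.k * (d.excess d.ubar t - d.excess d.ubar s) = d.I s t d.cstar := by
  unfold excess I
  linear_combination hP.Phi_ubar s - hP.Phi_ubar t

/-- At `β = 1`, if `u2` and `u3` exist, the maximality of `cstar` and of `ubar` gives strict
inequalities for the excess. -/
lemma excess_ubar_lt {a b : ℝ} (h : d.Crossings d.ubar a b) :
    d.excess d.ubar b < 0 ∧ d.excess d.ubar b - d.excess d.ubar a < d.K / d.k := by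
  have hk := hP.coeff.k_pos
  have hz := hP.ubar_lt_zlow
  have hza := h.zlow_lt
  have hlt := h.lt
  have h0 := hP.ubar_pos
  have ha0 : 0 < a := by linarith
  have hb0 : 0 < b := by linarith
  have hbU : d.cstar * d.dg b = d.k := by rw [← hP.dPhi_ubar hb0.le, h.right_eq, mul_one]
  have haU : d.cstar * d.dg a = d.k := by rw [← hP.dPhi_ubar ha0.le, h.left_eq, mul_one]
  have hne : ∀ s ∈ insert 0 d.U, s < b → d.I s b d.cstar ≠ d.K := fun s hs hsb heq => by
    have := hP.barrierData.ubar_max.2 ⟨⟨hb0.le, hbU⟩, s, hs, hsb, heq⟩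
    linarith
  constructor
  · have h1 := lt_of_le_of_ne (hP.I_le_K hb0 hbU.ge le_rfl hb0.le le_rfl)
      (hne 0 (mem_insert _ _) hb0)
    have h2 := hP.k_mul_excess_sub d.ubar b
    rw [hP.excess_self h0.le] at h2
    have h3 := hP.I_zero_ubar
    unfold I at h1 h2 h3
    by_contra! hcon
    nlinarith
  · rw [lt_div_iff₀ hk, mul_comm, hP.k_mul_excess_sub]
    exact lt_of_le_of_ne (hP.I_le_K hb0 hbU.ge ha0.le hlt.le le_rfl)
      (hne a (mem_insert_of_mem _ ⟨ha0.le, haU⟩) hlt)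

lemma excess_bound_of_one_le {w : ℝ} (hw : w ∈ Ico d.ubar d.zlow)
    (h : ∀ x, w ≤ x → 1 ≤ d.dPhi w x) :
    ∃ η > 0, (∀ x, d.zlow ≤ x → d.excess w x ≤ -η) ∧
      ∀ s t, d.zlow ≤ s → s ≤ t → d.excess w t - d.excess w s ≤ d.K / d.k - η := by
  have h0 := hP.ubar_pos.trans_le hw.1
  have hp := hP.lt_hMinusInv hw
  have hpz := (hP.hMinusInv_spec (hP.betaOf_mem_Ioc hw)).2.2
  have hanti : AntitoneOn (d.excess w) (Ici w) := by
    refine antitoneOn_of_deriv_nonpos (convex_Ici w)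
      ((hP.excess_cont w).mono fun x hx => h0.le.trans hx) (fun x hx => ?_) fun x hx => ?_
    all_goals
      rw [interior_Ici] at hx
      have hd := hP.excess_hasDerivAt w (h0.trans hx)
    · exact hd.differentiableAt.differentiableWithinAt
    · rw [hd.deriv]
      linarith [h x (le_of_lt hx)]
  have hneg : d.excess w d.zlow < 0 := by
    have h1 := hP.excess_strictAntiOn (u := w) (convex_Icc w (d.hMinusInv (d.betaOf w)))
      (fun x hx => h0.le.trans hx.1) (fun x hx => by
        rw [interior_Icc] at hx
        have := hP.dPhi_strictMonoOn hw (left_mem_Icc.2 hp.le) ⟨hx.1.le, hx.2.le⟩ hx.1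
        rwa [hP.dPhi_self h0.le] at this)
      (left_mem_Icc.2 hp.le) (right_mem_Icc.2 hp.le) hp
    rw [hP.excess_self h0.le] at h1
    exact (hanti hp.le hw.2.le hpz.le).trans_lt h1
  have hKk : 0 < d.K / d.k := div_pos hP.coeff.K_pos hP.coeff.k_pos
  refine ⟨min (-d.excess w d.zlow) (d.K / d.k), lt_min (by linarith) hKk, fun x hx => ?_,
    fun s t hs hst => ?_⟩
  · have h1 := hanti hw.2.le (hw.2.le.trans hx) hx
    have h2 := min_le_left (-d.excess w d.zlow) (d.K / d.k)
    linarith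
  · have h1 := hanti (hw.2.le.trans hs) (hw.2.le.trans (hs.trans hst)) hst
    have h2 := min_le_right (-d.excess w d.zlow) (d.K / d.k)
    linarith

lemma excess_bound_of_crossings {a b : ℝ} (h : d.Crossings d.ubar a b) :
    ∃ η > 0, (∀ x, d.zlow ≤ x → d.excess d.ubar x ≤ -η) ∧
      ∀ s t, d.zlow ≤ s → s ≤ t →
        d.excess d.ubar t - d.excess d.ubar s ≤ d.K / d.k - η := by
  have hz := hP.ubar_lt_zlow
  have hu : d.ubar ∈ Ico d.ubar d.zlow := ⟨le_rfl, hz⟩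
  have hlt := hP.excess_ubar_lt h
  have hneg : d.excess d.ubar d.zlow < 0 := by
    have := h.excess_anti hP hu ⟨le_rfl, (hz.trans h.zlow_lt).le⟩ ⟨hz.le, h.zlow_lt.le⟩ hz
    rwa [hP.excess_self hP.ubar_pos.le] at this
  set M := max (d.excess d.ubar d.zlow) (d.excess d.ubar b) with hM
  have hMneg : M < 0 := max_lt hneg hlt.1
  set N := d.K / d.k - (d.excess d.ubar b - d.excess d.ubar a) with hN
  refine ⟨min (-M) N, lt_min (by linarith) (by linarith), fun x hx => ?_, fun s t hs hst => ?_⟩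
  · have h1 := h.excess_le hP hu hz.le hx
    have h2 := min_le_left (-M) N
    linarith
  · have h1 := h.excess_sub_le hP hu (hz.le.trans hs) hst
    have h2 := min_le_right (-M) N
    linarith

end Problem1

/-! ### The two ends of `(α₀, β₀)` and the intermediate value argument -/

/-- A strict inequality for a continuous function of the tangency point persists to the left
of a point. -/
lemma _root_.ContinuousOn.exists_lt_left {f : ℝ → ℝ} (hf : ContinuousOn f (Ici 0))
    {l w c : ℝ} (hl : 0 ≤ l) (hlw : l < w) (h : f w < c) : ∃ u ∈ Ioo l w, f u < c := by
  have h1 := (hf.continuousAt (Ici_mem_nhds (hl.trans_lt hlw))).eventually_lt_const h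
  have h2 := (h1.filter_mono (nhdsWithin_le_nhds (s := Iio w))).and (Ioo_mem_nhdsLT hlw)
  obtain ⟨u, hu, hu'⟩ := h2.exists
  exact ⟨u, hu', hu⟩

lemma beta0_bdd (d : DividendModel) :
    BddAbove {b | b ∈ Ioc (d.h d.zlow) 1 ∧ ∀ β ∈ Ioc (d.h d.zlow) b, d.v β ≤ 1} :=
  ⟨1, fun _ hb => hb.1.2⟩

namespace Problem1
variable (hP : d.Problem1)
include hP

lemma u1_mem_Ico {β : ℝ} (hβ : β ∈ Ioc (d.h d.zlow) 1) : d.u1 β ∈ Ico d.ubar d.zlow := by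
  have h := hP.u1_spec ⟨hβ.1.le, hβ.2⟩
  refine ⟨h.1.1, lt_of_le_of_ne h.1.2 fun heq => ?_⟩
  have := h.2.1
  rw [heq, hP.betaOf_zlow] at this
  exact hβ.1.ne this

lemma dgb_div_u1 {β : ℝ} (hβ : β ∈ Icc (d.h d.zlow) 1) {x : ℝ} (hx : 0 ≤ x) :
    d.dgb β x / d.dgb β (d.u1 β) = d.dPhi (d.u1 β) x := by
  have h := hP.u1_spec hβ
  have := hP.dgb_div h.1 hx
  rwa [h.2.1] at this

lemma dgb_u1_pos {β : ℝ} (hβ : β ∈ Icc (d.h d.zlow) 1) : 0 < d.dgb β (d.u1 β) := by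
  have h := hP.u1_spec hβ
  have := hP.dgb_betaOf_pos h.1
  rwa [h.2.1] at this

lemma dgb_eq_iff {β : ℝ} (hβ : β ∈ Icc (d.h d.zlow) 1) {x : ℝ} (hx : 0 ≤ x) :
    d.dgb β x = d.dgb β (d.u1 β) ↔ d.dPhi (d.u1 β) x = 1 := by
  rw [← hP.dgb_div_u1 hβ hx, div_eq_one_iff_eq (hP.dgb_u1_pos hβ).ne']

lemma hPlusInv_pos {β : ℝ} (hβ : β ∈ Icc (d.h d.zlow) 1) : 0 < d.hPlusInv β :=
  hP.xlam_pos.trans (hP.hPlusInv_spec hβ).1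

lemma v_le_one {β x : ℝ} (hβ : β ∈ Ioo (d.h d.zlow) 1) (hx : d.u1 β ≤ x)
    (h : d.dPhi (d.u1 β) x < 1) : d.v β ≤ 1 := by
  have hβ' : β ∈ Icc (d.h d.zlow) 1 := ⟨hβ.1.le, hβ.2.le⟩
  have hlt : (β : EReal) < d.hInf := lt_of_lt_of_le (by exact_mod_cast hβ.2) hP.one_le_hInf
  rw [v, if_pos ⟨hβ', hlt⟩, hP.dgb_div_u1 hβ' (hP.hPlusInv_pos hβ').le]
  have h1 := hP.dPhi_hPlusInv_le (hP.u1_mem_Ico ⟨hβ.1, hβ.2.le⟩) hx h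
  rw [(hP.u1_spec hβ').2.1] at h1
  exact_mod_cast h1.trans h.le

lemma dPhi_zlow_lt_one {x : ℝ} (hx : d.zlow < x) (hxl : x ≤ d.xlam) : d.dPhi d.zlow x < 1 := by
  have hz : d.zlow ∈ Icc d.ubar d.zlow := ⟨hP.ubar_lt_zlow.le, le_rfl⟩
  have hc : d.curv (d.Phi d.zlow) (d.dPhi d.zlow) d.zlow = 0 := by
    rw [hP.curv_Phi hz hP.zlow_mem.1.1.le, hP.betaOf_zlow, sub_self, mul_zero]
  rw [← hP.dPhi_self hP.zlow_pos.le]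
  refine (hP.solPhi d.zlow).strictAntiOn_of_curv_neg hP.coeff (convex_Icc d.zlow x)
    (fun t ht => hP.zlow_pos.le.trans ht.1) (fun t ht _ => ?_) (left_mem_Icc.2 hx.le)
    (right_mem_Icc.2 hx.le) hx
  rw [interior_Icc] at ht
  rw [← hc]
  exact hP.curv_Phi_strictAntiOn hz.1 ⟨le_rfl, (ht.1.trans ht.2).le.trans hxl⟩
    ⟨ht.1.le, ht.2.le.trans hxl⟩ ht.1

lemma exists_beta0_mem : ∃ b, b ∈ Ioc (d.h d.zlow) 1 ∧ ∀ β ∈ Ioc (d.h d.zlow) b, d.v β ≤ 1 := by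
  have hz := hP.zlow_mem.1
  have hzu := hP.ubar_lt_zlow
  obtain ⟨u, hu, hlt⟩ := (hP.dPhi_cont_left d.xlam).exists_lt_left hP.ubar_pos.le hzu
    (hP.dPhi_zlow_lt_one hz.2 le_rfl)
  have hb := hP.betaOf_mem_Ioc ⟨hu.1.le, hu.2⟩
  have hb1 : d.betaOf u < 1 := by
    rw [← hP.betaOf_ubar]
    exact hP.betaOf_strictAntiOn ⟨le_rfl, hzu.le⟩ ⟨hu.1.le, hu.2.le⟩ hu.1
  refine ⟨d.betaOf u, hb, fun β hβ => ?_⟩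
  have hβ1 := hβ.2.trans_lt hb1
  have hu1 := hP.u1_mem_Ico ⟨hβ.1, hβ1.le⟩
  have hx := hu1.2.trans hz.2
  refine hP.v_le_one ⟨hβ.1, hβ1⟩ hx.le ?_
  rcases hβ.2.eq_or_lt with rfl | hlt'
  · rwa [hP.u1_betaOf ⟨hu.1.le, hu.2.le⟩]
  · have := hP.u1_lt_u1 ⟨hβ.1.le, hβ1.le⟩ ⟨hb.1.le, hb.2⟩ hlt'
    rw [hP.u1_betaOf ⟨hu.1.le, hu.2.le⟩] at this
    exact (hP.dPhi_lt hu.1.le this hu1.2.le hx.le).trans hlt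

lemma beta0_mem : d.beta0 ∈ Ioc (d.h d.zlow) 1 := by
  obtain ⟨b, hb⟩ := hP.exists_beta0_mem
  exact ⟨hb.1.1.trans_le (le_csSup d.beta0_bdd hb), csSup_le ⟨b, hb⟩ fun c hc => hc.1.2⟩

/-- Strict form of `v ≤ 1` below `beta0`: `v` increases strictly, since `dPhi (u1 β) x` does for
each fixed `x`. -/
lemma dPhi_hPlusInv_lt_one {β : ℝ} (hβ : β ∈ Ioo (d.h d.zlow) d.beta0) :
    d.dPhi (d.u1 β) (d.hPlusInv β) < 1 := by
  obtain ⟨b, hb, hlt⟩ := exists_lt_of_lt_csSup hP.exists_beta0_mem hβ.2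
  have hv := hb.2 b ⟨hb.1.1, le_rfl⟩
  have hb' : b ∈ Icc (d.h d.zlow) 1 := ⟨hb.1.1.le, hb.1.2⟩
  have hβ' : β ∈ Ioc (d.h d.zlow) 1 := ⟨hβ.1, hlt.le.trans hb.1.2⟩
  have hq := hP.hPlusInv_spec hb'
  have hle : d.dPhi (d.u1 b) (d.hPlusInv b) ≤ 1 := by
    rw [v] at hv
    split_ifs at hv with hif
    · rw [hP.dgb_div_u1 hb' (hP.hPlusInv_pos hb').le] at hv
      exact_mod_cast hv
    · exact absurd hv (not_le.2 (EReal.coe_lt_top 1))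
  have hub := hP.u1_mem_Ico hb.1
  have huβ := hP.u1_mem_Ico hβ'
  have hx : d.u1 β ≤ d.hPlusInv b := (huβ.2.trans (hP.zlow_mem.1.2.trans hq.1)).le
  have h1 := (hP.dPhi_lt hub.1 (hP.u1_lt_u1 ⟨hβ'.1.le, hβ'.2⟩ hb' hlt) huβ.2.le hx).trans_le hle
  have h2 := hP.dPhi_hPlusInv_le huβ hx h1
  rw [(hP.u1_spec ⟨hβ'.1.le, hβ'.2⟩).2.1] at h2
  exact h2.trans_lt h1

/-- If `beta0 < 1`, then `v (beta0) ≥ 1`: otherwise `v ≤ 1` slightly beyond `beta0`. -/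
lemma one_le_dPhi_beta0 (h1 : d.beta0 < 1) {x : ℝ} (hx : d.u1 d.beta0 ≤ x) :
    1 ≤ d.dPhi (d.u1 d.beta0) x := by
  by_contra! hcon
  have hb := hP.beta0_mem
  have hw := hP.u1_spec ⟨hb.1.le, hb.2⟩
  have hwz := hP.u1_mem_Ico hb
  have hlt : d.ubar < d.u1 d.beta0 := by
    refine lt_of_le_of_ne hw.1.1 fun heq => ?_
    have := hw.2.1
    rw [← heq, hP.betaOf_ubar] at this
    exact h1.ne' this
  obtain ⟨u, hu, hux⟩ := (hP.dPhi_cont_left x).exists_lt_left hP.ubar_pos.le hlt hcon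
  have hum : u ∈ Icc d.ubar d.zlow := ⟨hu.1.le, (hu.2.trans hwz.2).le⟩
  have hub : d.beta0 < d.betaOf u := by
    conv_lhs => rw [← hw.2.1]
    exact hP.betaOf_strictAntiOn hum hw.1 hu.2
  have hub1 : d.betaOf u < 1 := by
    rw [← hP.betaOf_ubar]
    exact hP.betaOf_strictAntiOn ⟨le_rfl, hP.ubar_lt_zlow.le⟩ hum hu.1
  refine absurd (le_csSup d.beta0_bdd ⟨⟨hb.1.trans hub, hub1.le⟩, fun β hβ => ?_⟩)
    (not_le.2 hub)
  have hβ1 := hβ.2.trans_lt hub1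
  have hβm : β ∈ Icc (d.h d.zlow) 1 := ⟨hβ.1.le, hβ1.le⟩
  have huβ := hP.u1_mem_Ico ⟨hβ.1, hβ1.le⟩
  rcases lt_or_ge β d.beta0 with hββ | hββ
  · have hq := hP.hPlusInv_spec hβm
    exact hP.v_le_one ⟨hβ.1, hβ1⟩ (huβ.2.trans (hP.zlow_mem.1.2.trans hq.1)).le
      (hP.dPhi_hPlusInv_lt_one ⟨hβ.1, hββ⟩)
  · have hle : d.u1 β ≤ d.u1 d.beta0 := by
      rcases hββ.eq_or_lt with heq | hlt'
      · rw [heq]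
      · exact (hP.u1_lt_u1 ⟨hb.1.le, hb.2⟩ hβm hlt').le
    refine hP.v_le_one ⟨hβ.1, hβ1⟩ (hle.trans hx) ?_
    rcases hβ.2.eq_or_lt with rfl | hlt'
    · rwa [hP.u1_betaOf hum]
    · have h3 := hP.u1_lt_u1 hβm (hP.betaOf_mem hum) hlt'
      rw [hP.u1_betaOf hum] at h3
      exact (hP.dPhi_lt hu.1.le h3 huβ.2.le (hle.trans hx)).trans hux

lemma G_eq {β : ℝ} (hβ : β ∈ Icc (d.h d.zlow) 1) :
    d.G β = liminf (fun x : ℝ => ((d.dPhi (d.u1 β) x : ℝ) : EReal)) atTop := by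
  refine liminf_congr ?_
  filter_upwards [eventually_ge_atTop 0] with x hx
  rw [hP.dgb_div_u1 hβ hx]

lemma alpha0_mem {a : ℝ} (ha : d.IsAlpha0 a) : a ∈ Ico (d.h d.zlow) d.beta0 := by
  rcases ha with h | h
  · rw [h.2]
    exact ⟨le_rfl, hP.beta0_mem.1⟩
  · exact ⟨h.2.1.1.le, h.2.1.2⟩

/-- To the left of `u1 α₀` the slope of `Phi u` exceeds `1` eventually, by a positive amount. -/
lemma eventually_one_lt_dPhi {a : ℝ} (ha : d.IsAlpha0 a) {u : ℝ} (hu : d.ubar ≤ u)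
    (hua : u < d.u1 a) : ∀ᶠ x in atTop, 1 < d.dPhi u x := by
  have ham := hP.alpha0_mem ha
  have ham' : a ∈ Icc (d.h d.zlow) 1 := ⟨ham.1, ham.2.le.trans hP.beta0_mem.2⟩
  have hG : (1 : EReal) ≤ d.G a := by
    rcases ha with h | h
    · rw [h.2]; exact h.1
    · exact h.2.2.ge
  rw [hP.G_eq ham'] at hG
  obtain ⟨δ, hδ, hle⟩ := hP.exists_dPhi_add_le hu hua (hP.u1_spec ham').1.2
  have hlt : ((1 - δ : ℝ) : EReal) < 1 := by exact_mod_cast (show 1 - δ < 1 by linarith)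
  filter_upwards [eventually_lt_of_lt_liminf (hlt.trans_le hG), eventually_ge_atTop d.xlam]
    with x hx hxl
  have hx' : 1 - δ < d.dPhi (d.u1 a) x := by exact_mod_cast hx
  linarith [hle x hxl]

lemma exists_crossings {a : ℝ} (ha : d.IsAlpha0 a) {u : ℝ} (hu : u ∈ Ico d.ubar d.zlow)
    (hua : u < d.u1 a) (hq1 : d.dPhi u (d.hPlusInv (d.betaOf u)) < 1) :
    (∃ s ∈ Ioo (d.hMinusInv (d.betaOf u)) (d.hPlusInv (d.betaOf u)), d.dPhi u s = 1) ∧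
      ∃ t ∈ Ioi (d.hPlusInv (d.betaOf u)), d.dPhi u t = 1 := by
  obtain ⟨X, hX, hXq⟩ := ((hP.eventually_one_lt_dPhi ha hu.1 hua).and
    (eventually_ge_atTop (d.hPlusInv (d.betaOf u)))).exists
  exact hP.exists_eq_one hu hq1 hXq hX

/-- The points `u2 β` and `u3 β` for `β` between `α₀` and `beta0`. -/
lemma u2_u3_spec {a : ℝ} (ha : d.IsAlpha0 a) {β : ℝ} (hβ : β ∈ Ioo a d.beta0) :
    d.hMinusInv β < d.u2 β ∧ d.u2 β < d.hPlusInv β ∧ d.hPlusInv β < d.u3 β ∧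
      d.dgb β (d.u2 β) = d.dgb β (d.u1 β) ∧ d.dgb β (d.u3 β) = d.dgb β (d.u1 β) ∧
      d.Crossings (d.u1 β) (d.u2 β) (d.u3 β) := by
  have ham := hP.alpha0_mem ha
  have hb0 := hP.beta0_mem
  have hβm : β ∈ Ioo (d.h d.zlow) d.beta0 := ⟨ham.1.trans_lt hβ.1, hβ.2⟩
  have hβ1 : β ∈ Ioc (d.h d.zlow) 1 := ⟨hβm.1, hβ.2.le.trans hb0.2⟩
  have hβ' : β ∈ Icc (d.h d.zlow) 1 := ⟨hβ1.1.le, hβ1.2⟩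
  have hu := hP.u1_mem_Ico hβ1
  have hbu := (hP.u1_spec hβ').2.1
  have hua := hP.u1_lt_u1 ⟨ham.1, ham.2.le.trans hb0.2⟩ hβ' hβ.1
  have hq1 := hP.dPhi_hPlusInv_lt_one hβm
  have hp0 : 0 < d.hMinusInv β := hP.caseR.x1_pos.trans_le (hP.hMinusInv_spec hβ1).1.1
  have hq0 := hP.hPlusInv_pos hβ'
  have hex := hP.exists_crossings ha hu hua (by rwa [hbu])
  rw [hbu] at hex
  obtain ⟨⟨s, hs, hs1⟩, t, ht, ht1⟩ := hex
  have hs' : ∃ s ∈ Ioo (d.hMinusInv β) (d.hPlusInv β), d.dgb β s = d.dgb β (d.u1 β) :=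
    ⟨s, hs, (hP.dgb_eq_iff hβ' (hp0.trans hs.1).le).2 hs1⟩
  have ht' : ∃ t ∈ Ioi (d.hPlusInv β), d.dgb β t = d.dgb β (d.u1 β) :=
    ⟨t, ht, (hP.dgb_eq_iff hβ' (hq0.trans ht).le).2 ht1⟩
  have m2 : d.u2 β ∈ Ioo (d.hMinusInv β) (d.hPlusInv β) := Function.invFunOn_mem hs'
  have e2 : d.dgb β (d.u2 β) = d.dgb β (d.u1 β) := Function.invFunOn_eq hs'
  have m3 : d.u3 β ∈ Ioi (d.hPlusInv β) := Function.invFunOn_mem ht'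
  have e3 : d.dgb β (d.u3 β) = d.dgb β (d.u1 β) := Function.invFunOn_eq ht'
  refine ⟨m2.1, m2.2, m3, e2, e3, ?_⟩
  exact hP.crossings_of_eq_one hu (by rwa [hbu]) (by rwa [hbu])
    ((hP.dgb_eq_iff hβ' (hp0.trans m2.1).le).1 e2) (by rw [hbu]; exact m3)
    ((hP.dgb_eq_iff hβ' (hq0.trans m3).le).1 e3)

lemma J_eq {β : ℝ} (hβ : β ∈ Icc (d.h d.zlow) 1) {s t : ℝ}
    (ht : d.dgb β t = d.dgb β (d.u1 β)) :
    d.J β s t = d.k * (d.excess (d.u1 β) t - d.excess (d.u1 β) s) := by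
  have h := hP.u1_spec hβ
  have h1 := hP.gb_div h.1 s
  have h2 := hP.gb_div h.1 t
  rw [h.2.1] at h1 h2
  rw [J, ht, sub_div, h1, h2, excess, excess]
  ring

lemma J_values {a : ℝ} (ha : d.IsAlpha0 a) {β : ℝ} (hβ : β ∈ Ioo a d.beta0) :
    d.J β (d.u1 β) (d.u2 β) = d.k * d.excess (d.u1 β) (d.u2 β) ∧
      d.J β (d.u1 β) (d.u3 β) = d.k * d.excess (d.u1 β) (d.u3 β) ∧
      d.J β (d.u2 β) (d.u3 β) =
        d.k * (d.excess (d.u1 β) (d.u3 β) - d.excess (d.u1 β) (d.u2 β)) := by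
  have ham := hP.alpha0_mem ha
  have hβ' : β ∈ Icc (d.h d.zlow) 1 := ⟨ham.1.trans hβ.1.le, hβ.2.le.trans hP.beta0_mem.2⟩
  obtain ⟨-, -, -, h2, h3, -⟩ := hP.u2_u3_spec ha hβ
  have h0 := hP.excess_self (hP.ubar_pos.le.trans (hP.u1_spec hβ').1.1)
  rw [hP.J_eq hβ' h2, hP.J_eq hβ' h3, hP.J_eq hβ' h3, h0, sub_zero, sub_zero]
  exact ⟨rfl, rfl, rfl⟩

/-- Near `beta0` the excess at `u3` is negative and its increase from `u2` to `u3` is less than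
`K / k`. Strict inequalities of this kind hold for the limiting normalized solution at
`u1 beta0`, and the difference to it is uniformly small on bounded intervals, being monotone. -/
lemma exists_near_beta0 {a : ℝ} (ha : d.IsAlpha0 a) : ∃ β ∈ Ioo a d.beta0,
    d.excess (d.u1 β) (d.u3 β) < 0 ∧
      d.excess (d.u1 β) (d.u3 β) - d.excess (d.u1 β) (d.u2 β) < d.K / d.k := by
  have ham := hP.alpha0_mem ha
  have hb := hP.beta0_mem
  have hb' : d.beta0 ∈ Icc (d.h d.zlow) 1 := ⟨hb.1.le, hb.2⟩
  have ha' : a ∈ Icc (d.h d.zlow) 1 := ⟨ham.1, ham.2.le.trans hb.2⟩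
  have hw := hP.u1_mem_Ico hb
  have hwa := hP.u1_lt_u1 ha' hb' ham.2
  have hbw := (hP.u1_spec hb').2.1
  obtain ⟨η, hη, hη1, hη2⟩ : ∃ η > 0,
      (∀ x, d.zlow ≤ x → d.excess (d.u1 d.beta0) x ≤ -η) ∧
      ∀ s t, d.zlow ≤ s → s ≤ t →
        d.excess (d.u1 d.beta0) t - d.excess (d.u1 d.beta0) s ≤ d.K / d.k - η := by
    by_cases hall : ∀ x, d.u1 d.beta0 ≤ x → 1 ≤ d.dPhi (d.u1 d.beta0) x
    · exact hP.excess_bound_of_one_le hw hall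
    · push Not at hall
      obtain ⟨x, hx, hx1⟩ := hall
      have hb1 : d.beta0 = 1 := le_antisymm hb.2 (not_lt.1 fun hlt =>
        absurd hx1 (not_lt.2 (hP.one_le_dPhi_beta0 hlt hx)))
      have hwu : d.u1 d.beta0 = d.ubar := by
        rw [hb1, ← hP.betaOf_ubar, hP.u1_betaOf ⟨le_rfl, hP.ubar_lt_zlow.le⟩]
      have hq1 := (hP.dPhi_hPlusInv_le hw hx hx1).trans_lt hx1
      obtain ⟨⟨s, hs, hs1⟩, t, ht, ht1⟩ := hP.exists_crossings ha hw hwa hq1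
      have hcr := hP.crossings_of_eq_one hw hq1 hs hs1 ht ht1
      rw [hwu] at hcr ⊢
      exact hP.excess_bound_of_crossings hcr
  obtain ⟨β₁, hβ₁⟩ := exists_between ham.2
  have hβ₁m : β₁ ∈ Icc (d.h d.zlow) 1 := ⟨ham.1.trans hβ₁.1.le, hβ₁.2.le.trans hb.2⟩
  obtain ⟨-, -, -, -, -, hcr₁⟩ := hP.u2_u3_spec ha hβ₁
  have hw1 := hP.u1_lt_u1 hβ₁m hb' hβ₁.2
  have hu₁ := hP.u1_mem_Ico ⟨ham.1.trans_lt hβ₁.1, hβ₁m.2⟩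
  set w := d.u1 d.beta0
  set X := d.u3 β₁
  obtain ⟨u, hu, huη⟩ : ∃ u ∈ Ioo w (d.u1 β₁), d.Phi w X - d.Phi u X < η := by
    have hw0 := hP.ubar_pos.trans_le hw.1
    have h1 : ContinuousAt (fun u => d.Phi w X - d.Phi u X) w :=
      continuousAt_const.sub ((hP.Phi_cont_left X).continuousAt (Ici_mem_nhds hw0))
    have h2 := (h1.eventually_lt_const (by simpa using hη)).filter_mono
      (nhdsWithin_le_nhds (s := Ioi w))
    obtain ⟨u, hu, hu'⟩ := (h2.and (Ioo_mem_nhdsGT hw1)).exists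
    exact ⟨u, hu', hu⟩
  have huz := hu.2.trans hu₁.2
  have hum : u ∈ Icc d.ubar d.zlow := ⟨hw.1.trans hu.1.le, huz.le⟩
  have hβ : d.betaOf u ∈ Ioo a d.beta0 := by
    refine ⟨hβ₁.1.trans ?_, ?_⟩
    · have := hP.betaOf_strictAntiOn hum ⟨hu₁.1, hu₁.2.le⟩ hu.2
      rwa [(hP.u1_spec hβ₁m).2.1] at this
    · have := hP.betaOf_strictAntiOn ⟨hw.1, hw.2.le⟩ hum hu.1
      rwa [hbw] at this
  refine ⟨d.betaOf u, hβ, ?_⟩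
  obtain ⟨-, -, -, -, -, hcr⟩ := hP.u2_u3_spec ha hβ
  rw [hP.u1_betaOf hum] at hcr ⊢
  have hbX := (hcr.mem_Ioo_right hP hcr₁ hum.1 hu.2 hu₁.2.le).2
  have hza := hcr.zlow_lt
  have hzb := hza.trans hcr.lt
  have hmono : MonotoneOn (fun x => d.Phi w x - d.Phi u x) (Ici u) := by
    have hu0 := hP.ubar_pos.trans_le hum.1
    refine monotoneOn_of_deriv_nonneg (convex_Ici u)
      (((hP.solPhi w).cont.sub (hP.solPhi u).cont).mono fun x hx => hu0.le.trans hx)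
      (fun x hx => ?_) fun x hx => ?_
    all_goals
      rw [interior_Ici] at hx
      have hd := ((hP.solPhi w).hasDeriv x (hu0.trans hx)).sub
        ((hP.solPhi u).hasDeriv x (hu0.trans hx))
    · exact hd.differentiableAt.differentiableWithinAt
    · have hd' : deriv (fun x => d.Phi w x - d.Phi u x) x = _ := hd.deriv
      rw [hd']
      linarith [hP.dPhi_lt hw.1 hu.1 hum.2 (le_of_lt hx)]
  have h1 : d.Phi w (d.u3 (d.betaOf u)) - d.Phi u (d.u3 (d.betaOf u)) ≤ d.Phi w X - d.Phi u X :=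
    hmono (huz.trans hzb).le (huz.trans (hzb.trans hbX)).le hbX.le
  have h2 := hP.Phi_lt hw.1 hu.1 hum.2 (huz.trans hza).le
  have h3 := hη1 _ hzb.le
  have h4 := hη2 _ _ hza.le hcr.lt.le
  unfold excess at h3 h4 ⊢
  constructor <;> linarith

/-- If `G(h(zlow)) ≥ 1`, the excess at `u3` is positive near `α₀ = h(zlow)`. -/
lemma exists_near_alpha0_of_G1 {a : ℝ} (ha : d.IsAlpha0 a) (hG : d.G1) :
    ∃ β ∈ Ioo a d.beta0, 0 < d.excess (d.u1 β) (d.u3 β) := by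
  have haz : a = d.h d.zlow := by
    rcases ha with h | h
    · exact h.2
    · exact absurd hG (not_le.2 h.1)
  have hz := hP.zlow_mem.1
  have hzm : d.zlow ∈ Icc d.ubar d.zlow := ⟨hP.ubar_lt_zlow.le, le_rfl⟩
  have hb := hP.beta0_mem
  have hb' : d.beta0 ∈ Icc (d.h d.zlow) 1 := ⟨hb.1.le, hb.2⟩
  have hw := hP.u1_mem_Ico hb
  have hpos : 0 < d.excess d.zlow d.xlam := by
    have := hP.excess_strictMonoOn (u := d.zlow) (convex_Icc d.zlow d.xlam)
      (fun x hx => hP.zlow_pos.le.trans hx.1) (fun x hx => by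
        rw [interior_Icc] at hx
        exact hP.dPhi_zlow_lt_one hx.1 hx.2.le)
      (left_mem_Icc.2 hz.2.le) (right_mem_Icc.2 hz.2.le) hz.2
    rwa [hP.excess_self hP.zlow_pos.le] at this
  obtain ⟨u, hu, hux⟩ := (hP.Phi_cont_left d.xlam).exists_lt_left
    (c := d.xlam - d.K / d.k) (hP.ubar_pos.le.trans hw.1) hw.2 (by
      unfold excess at hpos
      linarith)
  have hum : u ∈ Icc d.ubar d.zlow := ⟨hw.1.trans hu.1.le, hu.2.le⟩
  have hβ : d.betaOf u ∈ Ioo a d.beta0 := by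
    constructor
    · rw [haz, ← hP.betaOf_zlow]
      exact hP.betaOf_strictAntiOn hum hzm hu.2
    · have := hP.betaOf_strictAntiOn ⟨hw.1, hw.2.le⟩ hum hu.1
      rwa [(hP.u1_spec hb').2.1] at this
  refine ⟨d.betaOf u, hβ, ?_⟩
  obtain ⟨-, -, -, -, -, hcr⟩ := hP.u2_u3_spec ha hβ
  rw [hP.u1_betaOf hum] at hcr ⊢
  have hex : 0 < d.excess u d.xlam := by
    unfold excess
    linarith
  have h1 := hcr.excess_le hP ⟨hum.1, hu.2⟩ le_rfl (hu.2.trans hz.2).le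
  rw [hP.excess_self (hP.ubar_pos.le.trans hum.1)] at h1
  rcases le_max_iff.1 h1 with h2 | h2
  · linarith
  · linarith

/-- A number below the limit inferior at `α₀` is exceeded for some `β` in `(α₀, beta0)`. -/
lemma exists_of_lt_liminf {a : ℝ} (ha : d.IsAlpha0 a) {f : ℝ → ℝ} {c : ℝ}
    (h : (c : EReal) < liminf (fun β : ℝ => ((f β : ℝ) : EReal)) (𝓝[>] a)) :
    ∃ β ∈ Ioo a d.beta0, c < f β := by
  obtain ⟨β, hβ, hβ'⟩ := ((eventually_lt_of_lt_liminf h).and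
    (Ioo_mem_nhdsGT (hP.alpha0_mem ha).2)).exists
  exact ⟨β, hβ', by exact_mod_cast hβ⟩

/-- The excess at `u3` decreases in `β`. -/
lemma excess_u3_lt {a : ℝ} (ha : d.IsAlpha0 a) {β β' : ℝ} (hβ : β ∈ Ioo a d.beta0)
    (hβ' : β' ∈ Ioo a d.beta0) (h : β < β') :
    d.excess (d.u1 β') (d.u3 β') < d.excess (d.u1 β) (d.u3 β) := by
  have ham := hP.alpha0_mem ha
  have hb := hP.beta0_mem
  have hm : β ∈ Ioc (d.h d.zlow) 1 := ⟨ham.1.trans_lt hβ.1, hβ.2.le.trans hb.2⟩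
  have hm' : β' ∈ Ioc (d.h d.zlow) 1 := ⟨ham.1.trans_lt hβ'.1, hβ'.2.le.trans hb.2⟩
  have hu := hP.u1_mem_Ico hm
  have hu' := hP.u1_mem_Ico hm'
  have hlt := hP.u1_lt_u1 ⟨hm.1.le, hm.2⟩ ⟨hm'.1.le, hm'.2⟩ h
  obtain ⟨-, -, -, -, -, hcr⟩ := hP.u2_u3_spec ha hβ
  obtain ⟨-, -, -, -, -, hcr'⟩ := hP.u2_u3_spec ha hβ'
  have hmem := hcr'.mem_Ioo_right hP hcr hu'.1 hlt hu.2.le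
  have h1 := hcr.excess_le_right hP hmem.1.le
  have h2 := hP.Phi_lt hu'.1 hlt hu.2.le (hu.2.trans (hcr'.zlow_lt.trans hcr'.lt)).le
  refine lt_of_lt_of_le ?_ h1
  unfold excess
  linarith

lemma excess_u3_neg_of_J13lim_neg {a : ℝ} (ha : d.IsAlpha0 a) (hG : d.J13lim a < 0) {β : ℝ}
    (hβ : β ∈ Ioo a d.beta0) : d.excess (d.u1 β) (d.u3 β) < 0 := by
  by_contra! hcon
  refine absurd hG (not_lt.2 (le_liminf_of_le (by isBoundedDefault) ?_))
  filter_upwards [Ioo_mem_nhdsGT hβ.1] with t ht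
  have htm : t ∈ Ioo a d.beta0 := ⟨ht.1, ht.2.trans hβ.2⟩
  rw [(hP.J_values ha htm).2.1]
  have := hcon.trans (hP.excess_u3_lt ha htm hβ ht.2).le
  exact_mod_cast mul_nonneg hP.coeff.k_pos.le this

/-- Near `α₀` either the excess at `u3` is positive, or its increase from `u2` to `u3` is larger
than `K / k`. -/
lemma exists_near_alpha0 {a : ℝ} (ha : d.IsAlpha0 a) (hG : d.G1 ∨ d.G2 a ∨ d.G3 a)
    (hedge : d.G2 a → d.J13lim a = 0 → (d.K : EReal) < d.J2lim a) : ∃ β ∈ Ioo a d.beta0,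
    0 < d.excess (d.u1 β) (d.u3 β) ∨
      d.K / d.k < d.excess (d.u1 β) (d.u3 β) - d.excess (d.u1 β) (d.u2 β) := by
  have hk := hP.coeff.k_pos
  have hJ2 : (d.K : EReal) < d.J2lim a → ∃ β ∈ Ioo a d.beta0,
      0 < d.excess (d.u1 β) (d.u3 β) ∨
        d.K / d.k < d.excess (d.u1 β) (d.u3 β) - d.excess (d.u1 β) (d.u2 β) := by
    intro h
    obtain ⟨β, hβ, hlt⟩ := hP.exists_of_lt_liminf ha h
    rw [(hP.J_values ha hβ).2.2] at hlt
    exact ⟨β, hβ, Or.inr (by rwa [div_lt_iff₀' hk])⟩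
  rcases hG with h | h | h
  · obtain ⟨β, hβ, hlt⟩ := hP.exists_near_alpha0_of_G1 ha h
    exact ⟨β, hβ, Or.inl hlt⟩
  · rcases h.2.eq_or_lt with h0 | h0
    · exact hJ2 (hedge h h0.symm)
    · obtain ⟨β, hβ, hlt⟩ := hP.exists_of_lt_liminf (c := 0) ha (by exact_mod_cast h0)
      rw [(hP.J_values ha hβ).2.1] at hlt
      exact ⟨β, hβ, Or.inl ((pos_iff_pos_of_mul_pos hlt).1 hk)⟩
  · exact hJ2 h.2.2

/-- The intermediate value step: the maximum of the excess at `u3` and of its increase from `u2`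
to `u3`, less `K / k`, is a continuous function of the tangency point `u1` and changes sign. -/
lemma exists_balanced {a : ℝ} (ha : d.IsAlpha0 a) (hG : d.G1 ∨ d.G2 a ∨ d.G3 a)
    (hedge : d.G2 a → d.J13lim a = 0 → (d.K : EReal) < d.J2lim a) : ∃ β ∈ Ioo a d.beta0,
    max (d.excess (d.u1 β) (d.u3 β))
      (d.excess (d.u1 β) (d.u3 β) - d.excess (d.u1 β) (d.u2 β) - d.K / d.k) = 0 := by
  have ham := hP.alpha0_mem ha
  have hb := hP.beta0_mem
  have hb' : d.beta0 ∈ Icc (d.h d.zlow) 1 := ⟨hb.1.le, hb.2⟩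
  have ha' : a ∈ Icc (d.h d.zlow) 1 := ⟨ham.1, ham.2.le.trans hb.2⟩
  have hua := hP.u1_spec ha'
  have hw := hP.u1_mem_Ico hb
  obtain ⟨β₁, hβ₁, hpos⟩ := hP.exists_near_alpha0 ha hG hedge
  obtain ⟨β₂, hβ₂, hneg⟩ := hP.exists_near_beta0 ha
  have hmem : ∀ β ∈ Ioo a d.beta0, β ∈ Icc (d.h d.zlow) 1 := fun β hβ =>
    ⟨ham.1.trans hβ.1.le, hβ.2.le.trans hb.2⟩
  set S := Ioo (d.u1 d.beta0) (d.u1 a) with hS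
  have hSm : ∀ u ∈ S, u ∈ Ico d.ubar d.zlow := fun u hu =>
    ⟨hw.1.trans hu.1.le, hu.2.trans_le hua.1.2⟩
  have hSβ : ∀ u ∈ S, d.betaOf u ∈ Ioo a d.beta0 := by
    intro u hu
    have hum : u ∈ Icc d.ubar d.zlow := ⟨(hSm u hu).1, (hSm u hu).2.le⟩
    constructor
    · have := hP.betaOf_strictAntiOn hum hua.1 hu.2
      rwa [hua.2.1] at this
    · have := hP.betaOf_strictAntiOn ⟨hw.1, hw.2.le⟩ hum hu.1
      rwa [(hP.u1_spec hb').2.1] at this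
  have hu1S : ∀ β ∈ Ioo a d.beta0, d.u1 β ∈ S := fun β hβ =>
    ⟨hP.u1_lt_u1 (hmem β hβ) hb' hβ.2, hP.u1_lt_u1 ha' (hmem β hβ) hβ.1⟩
  have hcr : ∀ u ∈ S, d.Crossings u (d.u2 (d.betaOf u)) (d.u3 (d.betaOf u)) := by
    intro u hu
    have := (hP.u2_u3_spec ha (hSβ u hu)).2.2.2.2.2
    rwa [hP.u1_betaOf ⟨(hSm u hu).1, (hSm u hu).2.le⟩] at this
  have hS0 : S ⊆ Ici 0 := fun u hu => hP.ubar_pos.le.trans (hSm u hu).1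
  obtain ⟨hca, hcb⟩ := hP.crossings_cont (S := S) hSm
    (a := fun u => d.u2 (d.betaOf u)) (b := fun u => d.u3 (d.betaOf u)) hcr
  have hea : ContinuousOn (fun u => d.excess u (d.u2 (d.betaOf u))) S :=
    (hca.sub continuousOn_const).sub (hP.Phi_comp_cont hS0 hca fun u hu =>
      hP.zlow_pos.le.trans (hcr u hu).zlow_lt.le)
  have heb : ContinuousOn (fun u => d.excess u (d.u3 (d.betaOf u))) S :=
    (hcb.sub continuousOn_const).sub (hP.Phi_comp_cont hS0 hcb fun u hu =>
      hP.zlow_pos.le.trans ((hcr u hu).zlow_lt.trans (hcr u hu).lt).le)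
  have hcont : ContinuousOn (fun u => max (d.excess u (d.u3 (d.betaOf u)))
      (d.excess u (d.u3 (d.betaOf u)) - d.excess u (d.u2 (d.betaOf u)) - d.K / d.k)) S :=
    heb.sup ((heb.sub hea).sub continuousOn_const)
  obtain ⟨u, hu, hu0⟩ := isPreconnected_Ioo.intermediate_value (hu1S β₂ hβ₂) (hu1S β₁ hβ₁) hcont
    (show (0 : ℝ) ∈ Icc _ _ from by
      simp only [(hP.u1_spec (hmem β₁ hβ₁)).2.1, (hP.u1_spec (hmem β₂ hβ₂)).2.1]
      refine ⟨max_le hneg.1.le (by linarith [hneg.2]), ?_⟩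
      rcases hpos with h | h
      · exact le_max_of_le_left h.le
      · exact le_max_of_le_right (by linarith))
  refine ⟨d.betaOf u, hSβ u hu, ?_⟩
  rwa [hP.u1_betaOf ⟨(hSm u hu).1, (hSm u hu).2.le⟩]

end Problem1

end DividendModel

end

theorem proposition2p1 (d : DividendModel) (hP : d.Problem1) (α₀ : ℝ) (hα : d.IsAlpha0 α₀)
    (hG : d.G1 ∨ d.G2 α₀ ∨ d.G3 α₀)
    (hedge : d.G2 α₀ → d.J13lim α₀ = 0 → (d.K : EReal) < d.J2lim α₀) :
    ∃ β ∈ Set.Ioo α₀ d.beta0,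
      d.ubar < d.u1 β ∧ d.u1 β < d.hMinusInv β ∧ d.hMinusInv β < d.zlow ∧ d.zlow < d.u2 β ∧
      d.u2 β < d.hPlusInv β ∧ d.hPlusInv β < d.u3 β ∧
      d.gamma β (d.u1 β) = 0 ∧
      d.dgb β (d.u1 β) = d.dgb β (d.u2 β) ∧ d.dgb β (d.u2 β) = d.dgb β (d.u3 β) ∧
      Xor
        (-d.J β (d.u1 β) (d.u2 β) = d.J β (d.u2 β) (d.u3 β) ∧ d.J β (d.u2 β) (d.u3 β) ≤ d.K)
        (-d.J β (d.u1 β) (d.u2 β) > d.J β (d.u2 β) (d.u3 β) ∧ d.J β (d.u2 β) (d.u3 β) = d.K) ∧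
      (d.G3 α₀ →
        -d.J β (d.u1 β) (d.u2 β) > d.J β (d.u2 β) (d.u3 β) ∧
          d.J β (d.u2 β) (d.u3 β) = d.K) := by
  obtain ⟨β, hβ, hmax⟩ := hP.exists_balanced hα hG hedge
  have ham := hP.alpha0_mem hα
  have hb := hP.beta0_mem
  have hβm : β ∈ Set.Ioc (d.h d.zlow) 1 := ⟨ham.1.trans_lt hβ.1, hβ.2.le.trans hb.2⟩
  have hs := hP.u1_spec ⟨hβm.1.le, hβm.2⟩
  have hu := hP.u1_mem_Ico hβm
  have hlt := hP.lt_hMinusInv hu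
  rw [hs.2.1] at hlt
  obtain ⟨-, h2, h3, e2, e3, hcr⟩ := hP.u2_u3_spec hα hβ
  obtain ⟨hJ12, -, hJ23⟩ := hP.J_values hα hβ
  have hk := hP.coeff.k_pos
  have hubar : d.ubar < d.u1 β := by
    refine lt_of_le_of_ne hu.1 fun heq => ?_
    have h1 := hs.2.1
    rw [← heq, hP.betaOf_ubar] at h1
    linarith [hβ.2, hb.2]
  refine ⟨β, hβ, hubar, hlt, (hP.hMinusInv_spec hβm).2.2, hcr.zlow_lt, h2, h3, hs.2.2,
    e2.symm, e2.trans e3.symm, ?_, ?_⟩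
  all_goals
    rw [hJ12, hJ23]
    set E2 := d.excess (d.u1 β) (d.u2 β)
    set E3 := d.excess (d.u1 β) (d.u3 β) with hE3
    have hK : d.k * (d.K / d.k) = d.K := mul_div_cancel₀ _ hk.ne'
    have hcase : (E3 = 0 ∧ E3 - E2 ≤ d.K / d.k) ∨ (E3 < 0 ∧ E3 - E2 = d.K / d.k) := by
      have h4 := hmax.le
      rw [max_le_iff] at h4
      rcases h4.1.eq_or_lt with h5 | h5
      · exact Or.inl ⟨h5, by linarith [h4.2]⟩
      · rcases max_choice E3 (E3 - E2 - d.K / d.k) with h6 | h6 <;> rw [h6] at hmax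
        · exact absurd hmax h5.ne
        · exact Or.inr ⟨h5, by linarith⟩
    have hb' : E3 < 0 ∧ E3 - E2 = d.K / d.k →
        -(d.k * E2) > d.k * (E3 - E2) ∧ d.k * (E3 - E2) = d.K := by
      rintro ⟨h5, h6⟩
      exact ⟨by nlinarith, by rw [h6, hK]⟩
  · rcases hcase with ⟨h5, h6⟩ | h5
    · refine Or.inl ⟨⟨by rw [h5]; ring, ?_⟩, fun h7 => ?_⟩
      · rw [← hK]
        exact mul_le_mul_of_nonneg_left h6 hk.le
      · have := h7.1
        rw [h5] at this
        linarith
    · have h6 := hb' h5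
      exact Or.inr ⟨h6, fun h7 => h6.1.ne' h7.1⟩
  · intro hG3
    rcases hcase with ⟨h5, -⟩ | h5
    · have := hP.excess_u3_neg_of_J13lim_neg hα hG3.2.1 hβ
      exact absurd h5 this.ne
    · exact hb' h5
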